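/- There is an absolute constant $c_0>0$ such that the following holds. Let $n\ge 1$ be an integer, let $f\ge 0$ belong to $\mathbb{L}_1(\mathbb{R})\cap\mathbb{L}_2(\mathbb{R})$, and let $N$ be a Poisson process on $\mathbb{R}$ with mean measure $n f(x)\,dx$; write $\int g\,dN=\sum_{T\in N}g(T)$. Let $(\varphi_\lambda)_{\lambda\in\Lambda}$ and $(\tilde\varphi_\lambda)_{\lambda\in\Lambda}$ be two linearly independent families in $\mathbb{L}_2(\mathbb{R})$ such that $$f=\sum_{\lambda\in\Lambda}\beta_\lambda\tilde\varphi_\lambda\quad\text{(unconditionally in }\mathbb{L}_2),\qquad \beta_\lambda=\int f(x)\varphi_\lambda(x)\,dx,$$ and for $g=\sum_\lambda\alpha_\lambda\tilde\varphi_\lambda$ set $\|g\|_{\tilde\varphi}^2=\sum_\lambda\alpha_\lambda^2\in[0,\infty]$, a function of the coefficients of the expansion. Let $\Gamma_n\subset\Lambda$ and let $c_{\varphi,n}$, $m_{\varphi,n}$ be real numbers such that $\|\varphi_\lambda\|_\infty\le c_{\varphi,n}\sqrt n$ for all $\lambda\in\Gamma_n$, and $\mathrm{card}\{\lambda\in\Gamma_n:\varphi_\lambda(x)\ne0\}\le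 m_{\varphi,n}\ln n$ for all $x\in\mathbb{R}$. Let $\gamma>1$, and put $$\hat\beta_\lambda=\frac1n\int\varphi_\lambda\,dN,\qquad \hat V_{\lambda,n}=\int\frac{\varphi_\lambda^2}{n^2}\,dN,\qquad \tilde V_{\lambda,n}=\hat V_{\lambda,n}+\sqrt{2\gamma\ln n\,\hat V_{\lambda,n}\frac{\|\varphi_\lambda\|_\infty^2}{n^2}}+3\gamma\ln n\,\frac{\|\varphi_\lambda\|_\infty^2}{n^2},$$ $$\eta_{\lambda,\gamma}=\sqrt{2\gamma\ln n\,\tilde V_{\lambda,n}}+\frac{\gamma\ln n}{3n}\|\varphi_\lambda\|_\infty,\qquad \tilde\beta_\lambda=\hat\beta_\lambda 1_{|\hat\beta_\lambda|\ge\eta_{\lambda,\gamma}},\qquad \tilde f_{n,\gamma}=\sum_{\lambda\in\Gamma_n}\tilde\beta_\lambda\tilde\varphi_\lambda .$$ Then, almost surely, $\tilde f_{n,\gamma}-f=\sum_{\lambda\in\Lambda}(\tilde\beta_\lambda1_{\lambda\in\Gamma_n}-\beta_\lambda)\tilde\varphi_\lambda$ in $\mathbb{L}_2$, so that $\|\tilde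 f_{n,\gamma}-f\|_{\tilde\varphi}^2=\sum_{\lambda\in\Lambda}(\tilde\beta_\lambda1_{\lambda\in\Gamma_n}-\beta_\lambda)^2$; and for all $0<\varepsilon<\gamma-1$ and all $p\ge2$ and $q$ with $\frac1p+\frac1q=1$ and $\frac\gamma q>1+\varepsilon$, $$\frac{\varepsilon}{2+\varepsilon}\,\mathbb{E}\|\tilde f_{n,\gamma}-f\|_{\tilde\varphi}^2\le \mathbb{E}\left[\inf_{m\subset\Gamma_n}\left\{\left(1+\frac2\varepsilon\right)\sum_{\lambda\notin m}\beta_\lambda^2+\varepsilon\sum_{\lambda\in m}(\hat\beta_\lambda-\beta_\lambda)^2+\sum_{\lambda\in m}\eta_{\lambda,\gamma}^2\right\}\right]$$ $$\qquad+\,c_0(1+\varepsilon)p^2\|f\|_1c_{\varphi,n}^2m_{\varphi,n}\ln(n)\left[n^{-\frac{\gamma}{q(1+\varepsilon)}}+n^{-\frac\gamma q}\max(\|f\|_1,1)^{\frac1q}\right].$$ -/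

import Mathlib

open MeasureTheory ProbabilityTheory
open scoped ENNReal NNReal

noncomputable section

namespace PoissonThreshold

/-- `N` is a Poisson process on `ℝ` with mean measure `μ`: a random countable subset of `ℝ` such
that, for every Borel set `A`, the number of points of `N` in `A` is a random variable which has the
Poisson law with parameter `μ A` (and is almost surely infinite when `μ A = ∞`), and such that the
numbers of points in finitely many pairwise disjoint Borel sets are independent. -/
structure IsPoissonProcess {Ω : Type*} [MeasurableSpace Ω] (P : Measure Ω) (N : Ω → Set ℝ)
    (μ : Measure ℝ) : Prop where
  countable : ∀ ω, (N ω).Countable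
  measurable_count : ∀ A : Set ℝ, MeasurableSet A → Measurable fun ω => (N ω ∩ A).encard
  law_count : ∀ A : Set ℝ, MeasurableSet A → μ A ≠ ∞ →
    P.map (fun ω => (N ω ∩ A).encard) =
      (poissonMeasure (μ A).toNNReal).map (fun k : ℕ => (k : ℕ∞))
  count_eq_top : ∀ A : Set ℝ, MeasurableSet A → μ A = ∞ → ∀ᵐ ω ∂P, (N ω ∩ A).encard = ⊤
  indep_count : ∀ (k : ℕ) (A : Fin k → Set ℝ), (∀ i, MeasurableSet (A i)) →
    Pairwise (fun i j => Disjoint (A i) (A j)) →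
    iIndepFun (fun i ω => (N ω ∩ A i).encard) P

/-- The mean measure `n f(x) dx` of the observed process. -/
def meanMeasure (n : ℕ) (f : ℝ → ℝ) : Measure ℝ :=
  (n : ℝ≥0∞) • volume.withDensity fun x => ENNReal.ofReal (f x)

/-- The integral `∫ g dN = ∑_{T ∈ S} g T` of `g` against the counting measure of the (almost surely
finite) point set `S`. -/
def pointIntegral (S : Set ℝ) (g : ℝ → ℝ) : ℝ := ∑' T : S, g T

/-- The (essential) sup norm of `g`. -/
def supNorm (g : ℝ → ℝ) : ℝ := (eLpNorm g ∞ volume).toReal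

/-- The coefficient `β = ∫ f(x) g(x) dx` of `f` along `g`. -/
def coeff (f g : ℝ → ℝ) : ℝ := ∫ x, f x * g x

/-- The empirical coefficient `β̂ = (1/n) ∫ g dN`, where `S` is the observed set of points. -/
def coeffHat (n : ℕ) (S : Set ℝ) (g : ℝ → ℝ) : ℝ := (1 / (n : ℝ)) * pointIntegral S g

/-- The estimated variance `V̂ = ∫ g² / n² dN`. -/
def varHat (n : ℕ) (S : Set ℝ) (g : ℝ → ℝ) : ℝ :=
  pointIntegral S fun x => g x ^ 2 / (n : ℝ) ^ 2

/-- The corrected variance estimate `Ṽ`. -/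
def varTilde (γ : ℝ) (n : ℕ) (S : Set ℝ) (g : ℝ → ℝ) : ℝ :=
  varHat n S g
    + Real.sqrt (2 * γ * Real.log n * varHat n S g * (supNorm g ^ 2 / (n : ℝ) ^ 2))
    + 3 * γ * Real.log n * (supNorm g ^ 2 / (n : ℝ) ^ 2)

/-- The data-driven threshold `η`. -/
def threshold (γ : ℝ) (n : ℕ) (S : Set ℝ) (g : ℝ → ℝ) : ℝ :=
  Real.sqrt (2 * γ * Real.log n * varTilde γ n S g)
    + γ * Real.log n / (3 * (n : ℝ)) * supNorm g

open Classical in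
/-- The hard-thresholded coefficient `β̃ = β̂ 1_{|β̂| ≥ η}`. -/
def coeffTilde (γ : ℝ) (n : ℕ) (S : Set ℝ) (g : ℝ → ℝ) : ℝ :=
  if threshold γ n S g ≤ |coeffHat n S g| then coeffHat n S g else 0

/-- The thresholding estimator `f̃ = ∑_{λ ∈ Γ} β̃_λ φ̃_λ`, as an element of `L²`. -/
def estimator {Λ : Type*} (φ : Λ → ℝ → ℝ) (φt : Λ → Lp ℝ 2 (volume : Measure ℝ)) (Γ : Set Λ)
    (γ : ℝ) (n : ℕ) (S : Set ℝ) : Lp ℝ 2 (volume : Measure ℝ) :=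
  ∑' l : Γ, coeffTilde γ n S (φ l) • φt l

/-- The coefficient sequence of `f̃ - f`: `β̃_λ - β_λ` for `λ ∈ Γ` and `-β_λ` for `λ ∉ Γ`. -/
def errorCoeff {Λ : Type*} (φ : Λ → ℝ → ℝ) (Γ : Set Λ) (f : ℝ → ℝ) (γ : ℝ) (n : ℕ) (S : Set ℝ)
    (l : Λ) : ℝ :=
  Γ.indicator (fun l => coeffTilde γ n S (φ l)) l - coeff f (φ l)

/-- The squared norm `‖g‖_φ² = ∑_λ α_λ²` of `g = ∑_λ α_λ φ̃_λ`, as a function of the coefficients. -/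
def phiNormSq {Λ : Type*} (α : Λ → ℝ) : ℝ≥0∞ := ∑' l, ENNReal.ofReal (α l ^ 2)

/-- The criterion
`(1 + 2/ε) ∑_{λ ∉ m} β_λ² + ε ∑_{λ ∈ m} (β̂_λ - β_λ)² + ∑_{λ ∈ m} η_λ²` of a model `m`. -/
def criterion {Λ : Type*} (φ : Λ → ℝ → ℝ) (f : ℝ → ℝ) (γ ε : ℝ) (n : ℕ) (S : Set ℝ)
    (m : Set Λ) : ℝ≥0∞ :=
  ENNReal.ofReal (1 + 2 / ε) * (∑' l : (mᶜ : Set Λ), ENNReal.ofReal (coeff f (φ l) ^ 2))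
    + ENNReal.ofReal ε *
        (∑' l : m, ENNReal.ofReal ((coeffHat n S (φ l) - coeff f (φ l)) ^ 2))
    + ∑' l : m, ENNReal.ofReal (threshold γ n S (φ l) ^ 2)

/-- The norm `‖f‖₁`. -/
def l1Norm (f : ℝ → ℝ) : ℝ := ∫ x, |f x|

/-- The remainder, up to an absolute constant:
`(1+ε) p² ‖f‖₁ c² m ln n (n^(-γ/(q(1+ε))) + n^(-γ/q) max(‖f‖₁, 1)^(1/q))`. -/
def remainder (f : ℝ → ℝ) (n : ℕ) (c m γ ε p q : ℝ) : ℝ :=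
  (1 + ε) * p ^ 2 * l1Norm f * c ^ 2 * m * Real.log n *
    ((n : ℝ) ^ (-(γ / (q * (1 + ε)))) + (n : ℝ) ^ (-(γ / q)) * max (l1Norm f) 1 ^ (1 / q))

end PoissonThreshold

end

open PoissonThreshold

namespace PoissonThreshold

/-! ### Poisson point integrals and their Laplace functional. -/

section Poisson

variable {Ω : Type*} [MeasurableSpace Ω] {P : Measure Ω} {N : Ω → Set ℝ} {ν : Measure ℝ}

/-! The oracle inequality is a comparison made coefficient by coefficient on each path. Inside a
model `m`, hard thresholding costs at most the deviation and the squared threshold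
(`thresholded_sq_le_dev`). Outside `m` it costs at most a multiple of `β²`
(`thresholded_sq_le_bias`), unless the coefficient is kept while `β̂` misses `β` by more than
`(1+ε)^(-1/2) η`. The squared errors on these bad events, summed over all of `Γ`, do not depend on
`m`, so the infimum over `m` can be taken before the expectation (`phiNormSq_le_criterion`).

What remains is probabilistic. The Laplace functional of the process gives Bernstein's inequality.
Applied to `-g²` it shows that the corrected empirical variance rarely underestimates the true one,
so the data-driven threshold is a valid deviation bound (`IsPoissonProcess.deviation`). Put `F = ∫
f` over the set where `φ_λ ≠ 0`; each bad event must contribute an amount proportional to `F`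
(`exists_setLIntegral_badEvent_le`). If `nF ≥ 1`, Hölder's inequality and exponential moments
suffice. If `nF < 1`, the variance scale `c²F` need no longer dominate the squared sup bound;
instead, keeping the coefficient forces at least `γ ln n` points where `φ_λ ≠ 0`, which is very
unlikely. The overlap condition then sums the masses `F` to at most `m ln n ‖f‖₁`. -/

lemma pointIntegral_eq_sum {S : Set ℝ} (hS : S.Finite) (g : ℝ → ℝ) :
    pointIntegral S g = ∑ x ∈ hS.toFinset, g x := by
  have h := Finset.tsum_subtype hS.toFinset g
  rw [← h]
  unfold pointIntegral
  have : ∀ x, x ∈ S ↔ x ∈ hS.toFinset := by simp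
  exact (Equiv.tsum_eq (Equiv.subtypeEquivRight this) (fun x : hS.toFinset => g x))

lemma IsPoissonProcess.ae_encard_ne_top (h : IsPoissonProcess P N ν) {A : Set ℝ}
    (hA : MeasurableSet A) (hν : ν A ≠ ∞) : ∀ᵐ ω ∂P, (N ω ∩ A).encard ≠ ⊤ := by
  have h1 : ∀ᵐ k ∂(P.map (fun ω => (N ω ∩ A).encard)), k ≠ ⊤ := by
    rw [h.law_count A hA hν, ae_map_iff (Measurable.of_discrete.aemeasurable)
      (MeasurableSet.of_discrete)]
    simp
  exact ae_of_ae_map (h.measurable_count A hA).aemeasurable h1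

lemma IsPoissonProcess.ae_finite [IsFiniteMeasure ν] (h : IsPoissonProcess P N ν) :
    ∀ᵐ ω ∂P, (N ω).Finite := by
  filter_upwards [h.ae_encard_ne_top MeasurableSet.univ (measure_ne_top ν _)] with ω hω
  simpa [Set.encard_ne_top_iff] using hω

lemma lintegral_exp_poissonMeasure (r : ℝ≥0) (a : ℝ) :
    ∫⁻ k : ℕ, ENNReal.ofReal (Real.exp (a * (k : ℝ))) ∂poissonMeasure r =
      ENNReal.ofReal (Real.exp (r * (Real.exp a - 1))) := by
  rw [poissonMeasure, lintegral_sum_measure]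
  have h : HasSum (fun k : ℕ => Real.exp (-r) * r ^ k / k.factorial * Real.exp (a * k))
      (Real.exp (r * (Real.exp a - 1))) := by
    have h0 := (NormedSpace.expSeries_div_hasSum_exp (r * Real.exp a : ℝ)).mul_left
      (Real.exp (-r))
    rw [← Real.exp_eq_exp_ℝ, ← Real.exp_add] at h0
    convert! h0 using 1
    · ext k
      rw [mul_pow, ← Real.exp_nat_mul, mul_comm a]
      ring
    · congr 1; ring
  simp only [lintegral_smul_measure, lintegral_dirac, smul_eq_mul]
  rw [← h.tsum_eq, ENNReal.ofReal_tsum_of_nonneg (fun k => by positivity) h.summable]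
  refine tsum_congr fun k => ?_
  rw [ENNReal.ofReal_mul (by positivity)]

lemma IsPoissonProcess.lintegral_exp_count (h : IsPoissonProcess P N ν) {A : Set ℝ}
    (hA : MeasurableSet A) (hν : ν A ≠ ∞) (a : ℝ) :
    ∫⁻ ω, ENNReal.ofReal (Real.exp (a * ((N ω ∩ A).encard.toNat : ℝ))) ∂P =
      ENNReal.ofReal (Real.exp ((ν A).toReal * (Real.exp a - 1))) := by
  rw [← lintegral_map (f := fun k : ℕ∞ => ENNReal.ofReal (Real.exp (a * (k.toNat : ℝ))))
    Measurable.of_discrete (h.measurable_count A hA), h.law_count A hA hν,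
    lintegral_map Measurable.of_discrete Measurable.of_discrete]
  simp only [ENat.toNat_natCast]
  rw [lintegral_exp_poissonMeasure]
  rfl

/-- Lets almost everywhere bounds, such as those by the essential sup norm, be used at the points of
the process. The measurable hull is needed because `A` is arbitrary. -/
lemma IsPoissonProcess.ae_disjoint (h : IsPoissonProcess P N ν) {A : Set ℝ}
    (hA : ν A = 0) : ∀ᵐ ω ∂P, ∀ x ∈ N ω, x ∉ A := by
  set B := toMeasurable ν A
  have hB : MeasurableSet B := measurableSet_toMeasurable ν A
  have hνB : ν B = 0 := by rw [measure_toMeasurable, hA]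
  have h1 : ∀ᵐ k ∂(P.map (fun ω => (N ω ∩ B).encard)), k = 0 := by
    rw [h.law_count B hB (by simp [hνB]), hνB,
      ae_map_iff (Measurable.of_discrete.aemeasurable) (MeasurableSet.of_discrete), ae_iff]
    have : {k : ℕ | ¬ ((k : ℕ∞) = 0)} = {0}ᶜ := by ext; simp
    rw [this, prob_compl_eq_zero_iff MeasurableSet.of_discrete, poissonMeasure_singleton]
    simp
  filter_upwards [ae_of_ae_map (h.measurable_count B hB).aemeasurable h1] with ω hω x hx hxA
  rw [Set.encard_eq_zero] at hω
  exact (Set.eq_empty_iff_forall_notMem.1 hω) x ⟨hx, subset_toMeasurable ν A hxA⟩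

lemma pointIntegral_simpleFunc {S : Set ℝ} (hS : S.Finite) (s : SimpleFunc ℝ ℝ) :
    pointIntegral S s = ∑ a ∈ s.range, a * ((S ∩ s ⁻¹' {a}).encard.toNat : ℝ) := by
  classical
  rw [pointIntegral_eq_sum hS,
    ← Finset.sum_fiberwise_of_maps_to (g := s) (t := s.range) (fun x _ => s.mem_range_self x)]
  refine Finset.sum_congr rfl fun a _ => ?_
  rw [Finset.sum_congr rfl (g := fun _ => a) (fun x hx => (Finset.mem_filter.1 hx).2),
    Finset.sum_const, nsmul_eq_mul, mul_comm]
  congr 2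
  have : (S ∩ s ⁻¹' {a}) = (hS.toFinset.filter (fun x => s x = a) : Finset ℝ) := by
    ext x; simp
  rw [this, Set.encard_coe_eq_coe_finsetCard]
  simp

lemma IsPoissonProcess.aemeasurable_pointIntegral_simpleFunc [IsFiniteMeasure ν]
    (h : IsPoissonProcess P N ν) (s : SimpleFunc ℝ ℝ) :
    AEMeasurable (fun ω => pointIntegral (N ω) s) P := by
  refine ⟨fun ω => ∑ a ∈ s.range, a * ((N ω ∩ s ⁻¹' {a}).encard.toNat : ℝ), ?_, ?_⟩
  · refine Finset.measurable_sum _ fun a _ => Measurable.const_mul ?_ _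
    exact (Measurable.of_discrete (f := fun k : ℕ∞ => (k.toNat : ℝ))).comp
      (h.measurable_count _ (s.measurableSet_preimage _))
  · filter_upwards [h.ae_finite] with ω hω
    exact pointIntegral_simpleFunc hω s

/-- The point integral of a simple function is a linear combination of the counts on its disjoint
level sets. These are independent Poisson variables, so the exponential moment factorises. -/
lemma IsPoissonProcess.laplace_simpleFunc [IsFiniteMeasure ν]
    (h : IsPoissonProcess P N ν) (s : SimpleFunc ℝ ℝ) :
    ∫⁻ ω, ENNReal.ofReal (Real.exp (pointIntegral (N ω) s)) ∂P =
      ENNReal.ofReal (Real.exp (∫ x, (Real.exp (s x) - 1) ∂ν)) := by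
  set e := s.range.equivFin
  have hind := h.indep_count s.range.card (fun i => s ⁻¹' {((e.symm i : s.range) : ℝ)})
    (fun i => s.measurableSet_preimage _) (by
      intro i j hij
      refine Disjoint.preimage _ ?_
      simpa [Subtype.ext_iff] using fun h => hij (e.symm.injective (Subtype.ext h)))
  have hind2 := hind.comp (fun i k => ENNReal.ofReal (Real.exp (((e.symm i : s.range) : ℝ) *
    ((k : ℕ∞).toNat : ℝ)))) (fun i => Measurable.of_discrete)
  have hprod := lintegral_prod_eq_prod_lintegral_of_indepFun Finset.univ _ hind2 (fun i =>
    Measurable.of_discrete.comp (h.measurable_count _ (s.measurableSet_preimage _)))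
  have hsum : ∀ F : ℝ → ℝ, ∑ i, F (e.symm i : s.range) = ∑ a ∈ s.range, F a := by
    intro F
    rw [Equiv.sum_comp e.symm (fun a : s.range => F a), Finset.sum_coe_sort]
  calc ∫⁻ ω, ENNReal.ofReal (Real.exp (pointIntegral (N ω) s)) ∂P
      = ∫⁻ ω, ∏ i, ENNReal.ofReal (Real.exp (((e.symm i : s.range) : ℝ) *
          ((N ω ∩ s ⁻¹' {((e.symm i : s.range) : ℝ)}).encard.toNat : ℝ))) ∂P := by
        refine lintegral_congr_ae ?_
        filter_upwards [h.ae_finite] with ω hω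
        rw [pointIntegral_simpleFunc hω, ← ENNReal.ofReal_prod_of_nonneg
          (fun _ _ => (Real.exp_pos _).le), ← Real.exp_sum,
          hsum (fun a => a * ((N ω ∩ s ⁻¹' {a}).encard.toNat : ℝ))]
    _ = ∏ i, ∫⁻ ω, ENNReal.ofReal (Real.exp (((e.symm i : s.range) : ℝ) *
          ((N ω ∩ s ⁻¹' {((e.symm i : s.range) : ℝ)}).encard.toNat : ℝ))) ∂P := hprod
    _ = ENNReal.ofReal (Real.exp (∫ x, (Real.exp (s x) - 1) ∂ν)) := by
        rw [Finset.prod_congr rfl fun i _ => h.lintegral_exp_count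
          (s.measurableSet_preimage {((e.symm i : s.range) : ℝ)}) (measure_ne_top ν _) _]
        rw [← ENNReal.ofReal_prod_of_nonneg (fun _ _ => (Real.exp_pos _).le), ← Real.exp_sum,
          hsum (fun a => (ν (s ⁻¹' {a})).toReal * (Real.exp a - 1))]
        congr 2
        have h1 := SimpleFunc.map_integral (μ := ν) s (fun a => Real.exp a - 1)
          (SimpleFunc.integrable_of_isFiniteMeasure s) (by simp)
        rw [SimpleFunc.integral_eq_integral _ (SimpleFunc.integrable_of_isFiniteMeasure _)] at h1
        simp only [smul_eq_mul, SimpleFunc.coe_map, Function.comp_apply] at h1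
        rw [h1]; rfl

lemma tendsto_pointIntegral {S : Set ℝ} (hS : S.Finite) {s : ℕ → ℝ → ℝ} {g : ℝ → ℝ}
    (h : ∀ x, Filter.Tendsto (fun k => s k x) Filter.atTop (nhds (g x))) :
    Filter.Tendsto (fun k => pointIntegral S (s k)) Filter.atTop (nhds (pointIntegral S g)) := by
  simp_rw [pointIntegral_eq_sum hS]
  exact tendsto_finsetSum _ fun x _ => h x

lemma pointIntegral_congr {S : Set ℝ} {g g' : ℝ → ℝ} (h : ∀ x ∈ S, g x = g' x) :
    pointIntegral S g = pointIntegral S g' :=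
  tsum_congr fun x => h x x.2

lemma IsPoissonProcess.pointIntegral_ae_congr (h : IsPoissonProcess P N ν) {g g' : ℝ → ℝ}
    (hg : g =ᵐ[ν] g') : ∀ᵐ ω ∂P, pointIntegral (N ω) g = pointIntegral (N ω) g' := by
  filter_upwards [h.ae_disjoint (ae_iff.1 hg)] with ω hω
  exact pointIntegral_congr fun x hx => not_not.1 (hω x hx)

lemma IsPoissonProcess.aemeasurable_pointIntegral [IsFiniteMeasure ν]
    (h : IsPoissonProcess P N ν) {g : ℝ → ℝ} (hg : Measurable g) :
    AEMeasurable (fun ω => pointIntegral (N ω) g) P := by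
  refine aemeasurable_of_tendsto_metrizable_ae Filter.atTop
    (fun k => h.aemeasurable_pointIntegral_simpleFunc (hg.stronglyMeasurable.approx k)) ?_
  filter_upwards [h.ae_finite] with ω hω
  exact tendsto_pointIntegral hω hg.stronglyMeasurable.tendsto_approx

lemma exists_bounded_modification {g : ℝ → ℝ} (hg : Measurable g) {B : ℝ}
    (hB : 0 ≤ B) (hgB : ∀ᵐ x ∂ν, |g x| ≤ B) :
    ∃ g' : ℝ → ℝ, Measurable g' ∧ (∀ x, |g' x| ≤ B) ∧ g =ᵐ[ν] g' := by
  refine ⟨Set.indicator {x | |g x| ≤ B} g, hg.indicator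
    (measurableSet_le hg.abs measurable_const), fun x => ?_, ?_⟩
  · by_cases hx : |g x| ≤ B
    · rwa [Set.indicator_of_mem (by exact hx)]
    · rw [Set.indicator_of_notMem (by exact hx)]; simpa
  · filter_upwards [hgB] with x hx
    rw [Set.indicator_of_mem (by exact hx)]

/-- Upper bound on the Laplace functional of a Poisson process. -/
lemma IsPoissonProcess.laplace_le [IsFiniteMeasure ν]
    (h : IsPoissonProcess P N ν) {g : ℝ → ℝ} (hg : Measurable g) {B : ℝ}
    (hgB : ∀ᵐ x ∂ν, |g x| ≤ B) :
    ∫⁻ ω, ENNReal.ofReal (Real.exp (pointIntegral (N ω) g)) ∂P ≤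
      ENNReal.ofReal (Real.exp (∫ x, (Real.exp (g x) - 1) ∂ν)) := by
  wlog hB : 0 ≤ B generalizing B
  · exact this (B := |B|) (hgB.mono fun x hx => hx.trans (le_abs_self B)) (abs_nonneg B)
  obtain ⟨g', hg', hb, heq⟩ := exists_bounded_modification hg hB hgB
  rw [integral_congr_ae (g := fun x => Real.exp (g' x) - 1)
    (heq.mono fun x hx => by simp only [hx]),
    lintegral_congr_ae (g := fun ω => ENNReal.ofReal (Real.exp (pointIntegral (N ω) g')))
    ((h.pointIntegral_ae_congr heq).mono fun ω hω => by simp only [hω])]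
  set s : ℕ → SimpleFunc ℝ ℝ := hg'.stronglyMeasurable.approxBounded B
  have hs : ∀ x, Filter.Tendsto (fun k => s k x) Filter.atTop (nhds (g' x)) := fun x =>
    hg'.stronglyMeasurable.tendsto_approxBounded_of_norm_le (hb x)
  have hsB : ∀ k x, ‖s k x‖ ≤ B := fun k x => hg'.stronglyMeasurable.norm_approxBounded_le hB k x
  have hlim : Filter.Tendsto (fun k => ∫ x, (Real.exp (s k x) - 1) ∂ν) Filter.atTop
      (nhds (∫ x, (Real.exp (g' x) - 1) ∂ν)) := by
    refine tendsto_integral_of_dominated_convergence (fun _ => Real.exp B + 1) (fun k => ?_)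
      (integrable_const _) (fun k => Filter.Eventually.of_forall fun x => ?_)
      (Filter.Eventually.of_forall fun x => ?_)
    · exact ((Real.measurable_exp.comp (s k).measurable).sub_const 1).aestronglyMeasurable
    · refine (norm_sub_le _ _).trans ?_
      have := Real.exp_le_exp.2 ((le_abs_self _).trans (hsB k x))
      simp only [Real.norm_eq_abs, Real.abs_exp, abs_one]
      linarith
    · exact ((Real.continuous_exp.tendsto _).comp (hs x)).sub_const 1
  -- Fatou's lemma yields only an inequality, but upper bounds on exponential moments are all that
  -- the tail estimates use.
  have hfatou := lintegral_liminf_le' (μ := P) (u := Filter.atTop)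
    (f := fun k ω => ENNReal.ofReal (Real.exp (pointIntegral (N ω) (s k)))) (fun k =>
      (ENNReal.measurable_ofReal.comp Real.measurable_exp).comp_aemeasurable
        (h.aemeasurable_pointIntegral_simpleFunc (s k)))
  calc ∫⁻ ω, ENNReal.ofReal (Real.exp (pointIntegral (N ω) g')) ∂P
      = ∫⁻ ω, Filter.liminf (fun k => ENNReal.ofReal (Real.exp (pointIntegral (N ω) (s k))))
          Filter.atTop ∂P := by
        refine lintegral_congr_ae ?_
        filter_upwards [h.ae_finite] with ω hω
        refine (Filter.Tendsto.liminf_eq ?_).symm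
        exact ENNReal.tendsto_ofReal ((Real.continuous_exp.tendsto _).comp
          (tendsto_pointIntegral hω hs))
    _ ≤ _ := hfatou
    _ = ENNReal.ofReal (Real.exp (∫ x, (Real.exp (g' x) - 1) ∂ν)) := by
        simp_rw [h.laplace_simpleFunc]
        exact (ENNReal.tendsto_ofReal ((Real.continuous_exp.tendsto _).comp hlim)).liminf_eq

end Poisson

/-! ### Bernstein's inequality and the observable deviation bound. -/

/-- The quotient `(6 + 4y + y²) / (6 - 2y)` is a Padé approximant of `exp` at `0`. Differentiating
the difference twice reduces the claim to `1 - x ≤ exp (-x)`. For `y < 3` it is the Bernstein bound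
`exp y ≤ 1 + y + y² / (2(1 - y/3))`, valid for both signs of `y`. -/
lemma exp_mul_le_pade (y : ℝ) : (6 - 2 * y) * Real.exp y ≤ 6 + 4 * y + y ^ 2 := by
  have d1 : ∀ x : ℝ, HasDerivAt (fun x => 6 + 4 * x + x ^ 2 - (6 - 2 * x) * Real.exp x)
      (4 + 2 * x - (4 - 2 * x) * Real.exp x) x := by
    intro x
    have h := ((((hasDerivAt_id x).const_mul 4).const_add 6).add ((hasDerivAt_id x).pow 2)).sub
      ((((hasDerivAt_id x).const_mul 2).const_sub 6).mul (Real.hasDerivAt_exp x))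
    convert! h using 1
    simp; ring
  have d2 : ∀ x : ℝ, HasDerivAt (fun x => 4 + 2 * x - (4 - 2 * x) * Real.exp x)
      (2 - (2 - 2 * x) * Real.exp x) x := by
    intro x
    have h := ((((hasDerivAt_id x).const_mul 2).const_add 4)).sub
      ((((hasDerivAt_id x).const_mul 2).const_sub 4).mul (Real.hasDerivAt_exp x))
    convert! h using 1
    simp; ring
  have pos : ∀ x : ℝ, 0 ≤ 2 - (2 - 2 * x) * Real.exp x := by
    intro x
    have h1 := Real.add_one_le_exp (-x)
    have h2 : Real.exp (-x) * Real.exp x = 1 := by rw [← Real.exp_add]; simp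
    nlinarith [Real.exp_pos x]
  have mono : Monotone (fun x : ℝ => 4 + 2 * x - (4 - 2 * x) * Real.exp x) :=
    monotone_of_hasDerivAt_nonneg d2 pos
  have m0 : ∀ x : ℝ, 0 ≤ x → 0 ≤ 4 + 2 * x - (4 - 2 * x) * Real.exp x := by
    intro x hx; simpa using mono hx
  have m1 : ∀ x : ℝ, x ≤ 0 → 4 + 2 * x - (4 - 2 * x) * Real.exp x ≤ 0 := by
    intro x hx; simpa using mono hx
  have cont : Continuous (fun x : ℝ => 6 + 4 * x + x ^ 2 - (6 - 2 * x) * Real.exp x) := by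
    fun_prop
  rcases le_total 0 y with hy | hy
  · have := monotoneOn_of_hasDerivWithinAt_nonneg (convex_Ici (0 : ℝ)) cont.continuousOn
      (fun x _ => (d1 x).hasDerivWithinAt)
      (fun x hx => m0 x (by simpa using (interior_subset hx : x ∈ Set.Ici (0:ℝ))))
      (Set.mem_Ici.2 le_rfl) (Set.mem_Ici.2 hy) hy
    simp only [Real.exp_zero] at this
    linarith
  · have := antitoneOn_of_hasDerivWithinAt_nonpos (convex_Iic (0 : ℝ)) cont.continuousOn
      (fun x _ => (d1 x).hasDerivWithinAt)
      (fun x hx => m1 x (by simpa using (interior_subset hx : x ∈ Set.Iic (0:ℝ))))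
      (Set.mem_Iic.2 hy) (Set.mem_Iic.2 le_rfl) hy
    simp only [Real.exp_zero] at this
    linarith

lemma exp_sub_one_le_add_sq {y b : ℝ} (hy : y ≤ b) (hb : b < 3) :
    Real.exp y - 1 ≤ y + y ^ 2 * (2 * (1 - b / 3))⁻¹ := by
  have h := exp_mul_le_pade y
  have h1 : Real.exp y - 1 ≤ y + y ^ 2 * (2 * (1 - y / 3))⁻¹ := by
    have h3 : 0 < 6 - 2 * y := by linarith
    have : y + y ^ 2 * (2 * (1 - y / 3))⁻¹ = (6 + 4 * y + y ^ 2) / (6 - 2 * y) - 1 := by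
      have h4 : 3 - y ≠ 0 := by linarith
      have h5 : (2 * (1 - y / 3)) = (6 - 2 * y) / 3 := by ring
      rw [h5, inv_div, show 6 - 2 * y = 2 * (3 - y) by ring]
      field_simp
      ring
    rw [this, sub_le_sub_iff_right, le_div_iff₀ h3]
    linarith
  refine h1.trans ?_
  gcongr
  linarith

section Poisson

variable {Ω : Type*} [MeasurableSpace Ω] {P : Measure Ω} {N : Ω → Set ℝ} {ν : Measure ℝ}

lemma pointIntegral_const_mul (S : Set ℝ) (t : ℝ) (g : ℝ → ℝ) :
    pointIntegral S (fun x => t * g x) = t * pointIntegral S g :=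
  tsum_mul_left

lemma integrable_of_ae_abs_le [IsFiniteMeasure ν] {g : ℝ → ℝ} (hg : Measurable g) {B : ℝ}
    (hgB : ∀ᵐ x ∂ν, |g x| ≤ B) : Integrable g ν :=
  Integrable.of_bound hg.aestronglyMeasurable B hgB

lemma ae_sq_le {g : ℝ → ℝ} {B : ℝ} (hgB : ∀ᵐ x ∂ν, |g x| ≤ B) :
    ∀ᵐ x ∂ν, |g x ^ 2| ≤ B ^ 2 := by
  filter_upwards [hgB] with x hx
  rw [abs_pow]
  exact pow_le_pow_left₀ (abs_nonneg _) hx 2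

/-- Bernstein-type bound on the Laplace transform of a centred Poisson integral. -/
lemma IsPoissonProcess.laplace_centered_le [IsFiniteMeasure ν]
    (h : IsPoissonProcess P N ν) {g : ℝ → ℝ} (hg : Measurable g) {B t b : ℝ}
    (hgB : ∀ᵐ x ∂ν, |g x| ≤ B) (hb : |t| * B ≤ b) (hb3 : b < 3) :
    ∫⁻ ω, ENNReal.ofReal (Real.exp (t * (pointIntegral (N ω) g - ∫ x, g x ∂ν))) ∂P ≤
      ENNReal.ofReal (Real.exp (t ^ 2 * (∫ x, g x ^ 2 ∂ν) * (2 * (1 - b / 3))⁻¹)) := by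
  have hgi := integrable_of_ae_abs_le hg hgB
  have hg2 := integrable_of_ae_abs_le (hg.pow_const 2) (ae_sq_le hgB)
  have htg : ∀ᵐ x ∂ν, |t * g x| ≤ b := by
    filter_upwards [hgB] with x hx
    rw [abs_mul]
    exact (mul_le_mul_of_nonneg_left hx (abs_nonneg t)).trans hb
  have hl := h.laplace_le (hg.const_mul t) htg
  have hint : ∫ x, (Real.exp (t * g x) - 1) ∂ν ≤
      t * (∫ x, g x ∂ν) + t ^ 2 * (∫ x, g x ^ 2 ∂ν) * (2 * (1 - b / 3))⁻¹ := by
    have : t * (∫ x, g x ∂ν) + t ^ 2 * (∫ x, g x ^ 2 ∂ν) * (2 * (1 - b / 3))⁻¹ =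
        ∫ x, (t * g x + t ^ 2 * (2 * (1 - b / 3))⁻¹ * g x ^ 2) ∂ν := by
      rw [integral_add (hgi.const_mul t) (hg2.const_mul _), integral_const_mul,
        integral_const_mul]
      ring
    rw [this]
    refine integral_mono_ae ?_ ((hgi.const_mul t).add (hg2.const_mul _)) ?_
    · refine Integrable.of_bound
        ((Real.measurable_exp.comp (hg.const_mul t)).sub_const 1).aestronglyMeasurable
        (Real.exp b + 1) ?_
      filter_upwards [htg] with x hx
      refine (norm_sub_le _ _).trans ?_
      have := Real.exp_le_exp.2 ((le_abs_self _).trans hx)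
      simp only [Real.norm_eq_abs, Real.abs_exp, abs_one]
      linarith
    · filter_upwards [htg] with x hx
      refine (exp_sub_one_le_add_sq ((le_abs_self _).trans hx) hb3).trans_eq ?_
      ring
  have hsplit : ∀ ω, ENNReal.ofReal (Real.exp (t * (pointIntegral (N ω) g - ∫ x, g x ∂ν))) =
      ENNReal.ofReal (Real.exp (-(t * ∫ x, g x ∂ν))) *
        ENNReal.ofReal (Real.exp (pointIntegral (N ω) (fun x => t * g x))) := by
    intro ω
    rw [← ENNReal.ofReal_mul (Real.exp_pos _).le, ← Real.exp_add, pointIntegral_const_mul]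
    congr 2; ring
  simp_rw [hsplit]
  rw [lintegral_const_mul' _ _ ENNReal.ofReal_ne_top]
  refine (mul_le_mul_right hl _).trans ?_
  rw [← ENNReal.ofReal_mul (Real.exp_pos _).le, ← Real.exp_add]
  gcongr
  linarith

/-- Bernstein's inequality for Poisson integrals. -/
lemma IsPoissonProcess.bernstein [IsFiniteMeasure ν]
    (h : IsPoissonProcess P N ν) {g : ℝ → ℝ} (hg : Measurable g) {B v u : ℝ} (hB : 0 ≤ B)
    (hgB : ∀ᵐ x ∂ν, |g x| ≤ B) (hv : 0 < v) (hgv : ∫ x, g x ^ 2 ∂ν ≤ v) (hu : 0 ≤ u) :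
    P {ω | Real.sqrt (2 * u * v) + u * B / 3 ≤ pointIntegral (N ω) g - ∫ x, g x ∂ν} ≤
      ENNReal.ofReal (Real.exp (-u)) := by
  set s := Real.sqrt (2 * u / v) with hs
  have hs0 : 0 ≤ s := Real.sqrt_nonneg _
  have hs2 : s ^ 2 * v = 2 * u := by
    rw [hs, Real.sq_sqrt (by positivity)]; field_simp
  have hsv : Real.sqrt (2 * u * v) = s * v := by
    rw [← hs2, show s ^ 2 * v * v = (s * v) ^ 2 by ring, Real.sqrt_sq (by positivity)]
  have hpos : 0 < 1 + B / 3 * s := by positivity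
  -- With this `t` and `s² v = 2u`, the Laplace exponent is at most `u / (1 + Bs/3)`, while `t x = u
  -- + u / (1 + Bs/3)`; Markov's inequality then leaves exactly `exp (-u)`.
  set t := s / (1 + B / 3 * s) with ht
  have ht0 : 0 ≤ t := by positivity
  have hb3 : s * B / (1 + B / 3 * s) < 3 := by
    rw [div_lt_iff₀ hpos]; linarith
  have hl := h.laplace_centered_le hg (t := t) (b := s * B / (1 + B / 3 * s)) hgB
    (by rw [abs_of_nonneg ht0, ht]; exact (by ring : _ = _).le) hb3
  set X := fun ω => pointIntegral (N ω) g - ∫ x, g x ∂ν with hX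
  set x := Real.sqrt (2 * u * v) + u * B / 3 with hx
  have hXm : AEMeasurable (fun ω => ENNReal.ofReal (Real.exp (t * (X ω)))) P :=
    (ENNReal.measurable_ofReal.comp Real.measurable_exp).comp_aemeasurable
      (((h.aemeasurable_pointIntegral hg).sub_const _).const_mul t)
  have hmarkov := mul_meas_ge_le_lintegral₀ hXm (ENNReal.ofReal (Real.exp (t * x)))
  have hsub : {ω | x ≤ X ω} ⊆
      {ω | ENNReal.ofReal (Real.exp (t * x)) ≤ ENNReal.ofReal (Real.exp (t * X ω))} := by
    intro ω hω
    have hω' : x ≤ X ω := hω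
    change ENNReal.ofReal _ ≤ ENNReal.ofReal _
    gcongr
  have hle : ENNReal.ofReal (Real.exp (t * x)) * P {ω | x ≤ X ω} ≤
      ENNReal.ofReal (Real.exp (t * x)) * ENNReal.ofReal (Real.exp (-u)) := by
    refine ((mul_le_mul_right (measure_mono hsub) _).trans (hmarkov.trans hl)).trans ?_
    rw [← ENNReal.ofReal_mul (Real.exp_pos _).le, ← Real.exp_add]
    gcongr
    have h1 : 2 * (1 - s * B / (1 + B / 3 * s) / 3) = 2 / (1 + B / 3 * s) := by
      field_simp; ring
    have h2 : t * x = u + u / (1 + B / 3 * s) := by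
      rw [hx, hsv, ht]
      field_simp
      linear_combination 3 * hs2
    rw [h1, h2, inv_div]
    calc t ^ 2 * (∫ x, g x ^ 2 ∂ν) * ((1 + B / 3 * s) / 2)
        ≤ t ^ 2 * v * ((1 + B / 3 * s) / 2) := by gcongr
      _ = u / (1 + B / 3 * s) := by
        rw [ht]
        field_simp
        linear_combination hs2
      _ = u + u / (1 + B / 3 * s) + -u := by ring
  exact (ENNReal.mul_le_mul_iff_right (by simp [Real.exp_pos]) ENNReal.ofReal_ne_top).1 hle

lemma pointIntegral_neg (S : Set ℝ) (g : ℝ → ℝ) :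
    pointIntegral S (fun x => -g x) = -pointIntegral S g := by
  simpa using pointIntegral_const_mul S (-1) g

lemma pointIntegral_nonneg (S : Set ℝ) {g : ℝ → ℝ} (hg : ∀ x, 0 ≤ g x) :
    0 ≤ pointIntegral S g :=
  tsum_nonneg fun _ => hg _

/-- The observable deviation bound at level `u`, for a function bounded by `b` with empirical
second moment `V`. -/
noncomputable def devBound (u V b : ℝ) : ℝ :=
  Real.sqrt (2 * u * (V + Real.sqrt (2 * u * V * b ^ 2) + 3 * u * b ^ 2)) + u * b / 3

/-- Inverts a self-bounding inequality: the hypothesis is quadratic in `√V`, so `√V` is controlled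
by `√W` and `√w`. This is the source of the form of the corrected variance. -/
lemma le_of_le_add_sqrt {V W w : ℝ} (hV : 0 ≤ V) (hW : 0 ≤ W) (hw : 0 ≤ w)
    (h : V ≤ W + Real.sqrt (2 * w * V) + w / 3) :
    V ≤ W + Real.sqrt (2 * w * W) + 3 * w := by
  rw [Real.sqrt_mul (by positivity)] at h ⊢
  have h1 := Real.sq_sqrt hV
  have h2 := Real.sq_sqrt hW
  have h3 := Real.sq_sqrt (show 0 ≤ 2 * w by positivity)
  have p1 := Real.sqrt_nonneg V
  have p2 := Real.sqrt_nonneg W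
  have p3 := Real.sqrt_nonneg (2 * w)
  set r := Real.sqrt V
  set y := Real.sqrt W
  set z := Real.sqrt (2 * w)
  -- The constant `6/5` is large enough to contradict the hypothesis, as `6/5 · 1/5 ≥ 1/6`, and
  -- small enough for the conclusion, as `6/5 + 1/6 ≤ 3/2`.
  have hr : r ≤ y + 6 / 5 * z := by
    by_contra! hlt
    nlinarith [mul_nonneg p2 p3, mul_nonneg p3 p3]
  nlinarith [mul_le_mul_of_nonneg_left hr p3, mul_nonneg p3 p3]

/-- Bernstein's inequality for `-g²`, which is bounded by `b²` and has second moment at most `b² V`,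
bounds `V` by its empirical version plus a term in `√V`; `le_of_le_add_sqrt` removes that unknown
`√V`. -/
lemma IsPoissonProcess.variance_deviation [IsFiniteMeasure ν]
    (h : IsPoissonProcess P N ν) {g : ℝ → ℝ} (hg : Measurable g) {b u : ℝ} (hb : 0 < b)
    (hgb : ∀ᵐ x ∂ν, |g x| ≤ b) (hV : 0 < ∫ x, g x ^ 2 ∂ν) (hu : 0 ≤ u) :
    P {ω | pointIntegral (N ω) (fun x => g x ^ 2) +
        Real.sqrt (2 * u * pointIntegral (N ω) (fun x => g x ^ 2) * b ^ 2) + 3 * u * b ^ 2 <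
        ∫ x, g x ^ 2 ∂ν} ≤ ENNReal.ofReal (Real.exp (-u)) := by
  set V := ∫ x, g x ^ 2 ∂ν with hVdef
  have hg2 := integrable_of_ae_abs_le (hg.pow_const 2) (ae_sq_le hgb)
  have h4 : ∫ x, (-g x ^ 2) ^ 2 ∂ν ≤ b ^ 2 * V := by
    rw [hVdef, ← integral_const_mul]
    refine integral_mono_of_nonneg (Filter.Eventually.of_forall fun x => by positivity)
      (hg2.const_mul _) ?_
    filter_upwards [ae_sq_le hgb] with x hx
    rw [abs_of_nonneg (sq_nonneg _)] at hx
    nlinarith [sq_nonneg (g x)]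
  have hber := h.bernstein (g := fun x => -g x ^ 2) (hg.pow_const 2).neg (B := b ^ 2)
    (v := b ^ 2 * V) (u := u) (by positivity)
    (by simpa only [abs_neg] using ae_sq_le hgb) (by positivity) h4 hu
  refine (measure_mono fun ω hω => ?_).trans hber
  simp only [Set.mem_ofPred_eq] at hω ⊢
  rw [pointIntegral_neg _ (fun x => g x ^ 2), integral_neg, ← hVdef]
  by_contra! hlt
  have h0 := pointIntegral_nonneg (N ω) (g := fun x => g x ^ 2) (fun x => sq_nonneg _)
  have := le_of_le_add_sqrt hV.le h0 (show 0 ≤ u * b ^ 2 by positivity) (by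
    rw [show 2 * (u * b ^ 2) * V = 2 * u * (b ^ 2 * V) by ring]
    linarith)
  rw [show 2 * (u * b ^ 2) * pointIntegral (N ω) (fun x => g x ^ 2) =
    2 * u * pointIntegral (N ω) (fun x => g x ^ 2) * b ^ 2 by ring] at this
  linarith

/-- A Poisson integral deviates from its mean by more than the observable bound with
probability at most `3 exp (-u)`. -/
lemma IsPoissonProcess.deviation [IsFiniteMeasure ν]
    (h : IsPoissonProcess P N ν) {g : ℝ → ℝ} (hg : Measurable g) {b u : ℝ} (hb : 0 < b)
    (hgb : ∀ᵐ x ∂ν, |g x| ≤ b) (hV : 0 < ∫ x, g x ^ 2 ∂ν) (hu : 0 ≤ u) :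
    P {ω | devBound u (pointIntegral (N ω) (fun x => g x ^ 2)) b <
        |pointIntegral (N ω) g - ∫ x, g x ∂ν|} ≤ ENNReal.ofReal (3 * Real.exp (-u)) := by
  have h1 := h.variance_deviation hg hb hgb hV hu
  have h2 := h.bernstein hg hb.le hgb hV le_rfl hu
  have h3 := h.bernstein (g := fun x => -g x) hg.neg hb.le (by simpa only [abs_neg] using hgb)
    hV (by simp) hu
  -- Three events account for the factor 3: the variance is underestimated, or one of the two
  -- Bernstein tails occurs at the true variance.
  refine (measure_mono (fun ω hω => ?_)).trans (((measure_union_le _ _).trans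
    (add_le_add ((measure_union_le _ _).trans (add_le_add h1 h2)) h3)).trans_eq ?_)
  · simp only [Set.mem_ofPred_eq, Set.mem_union, devBound] at hω ⊢
    rw [pointIntegral_neg, integral_neg]
    set V := ∫ x, g x ^ 2 ∂ν
    by_cases hc : pointIntegral (N ω) (fun x => g x ^ 2) +
        Real.sqrt (2 * u * pointIntegral (N ω) (fun x => g x ^ 2) * b ^ 2) + 3 * u * b ^ 2 < V
    · exact Or.inl (Or.inl hc)
    · have := Real.sqrt_le_sqrt (mul_le_mul_of_nonneg_left (not_lt.1 hc)
        (show 0 ≤ 2 * u by positivity))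
      rcases lt_abs.1 hω with h' | h'
      · exact Or.inl (Or.inr (by linarith))
      · exact Or.inr (by linarith)
  · rw [← ENNReal.ofReal_add (by positivity) (by positivity),
      ← ENNReal.ofReal_add (by positivity) (by positivity)]
    congr 1; ring

end Poisson

/-! ### Second moments on unlikely events. -/

section Poisson

variable {Ω : Type*} [MeasurableSpace Ω] {P : Measure Ω} {N : Ω → Set ℝ} {ν : Measure ℝ}

/-- At scale `√W` both the sup bound and the variance are at most 1, so each sign has exponential
moment at most `exp (3/4) ≤ 3`. -/
lemma IsPoissonProcess.lintegral_exp_abs_le [IsFiniteMeasure ν]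
    (h : IsPoissonProcess P N ν) {g : ℝ → ℝ} (hg : Measurable g) {b W : ℝ} (hW : 0 < W)
    (hgb : ∀ᵐ x ∂ν, |g x| ≤ b) (hbW : b ^ 2 ≤ W) (hV : ∫ x, g x ^ 2 ∂ν ≤ W) :
    ∫⁻ ω, ENNReal.ofReal
      (Real.exp |(Real.sqrt W)⁻¹ * (pointIntegral (N ω) g - ∫ x, g x ∂ν)|) ∂P ≤ 6 := by
  set t := (Real.sqrt W)⁻¹ with ht
  have ht0 : 0 < t := by positivity
  have ht2 : t ^ 2 * W = 1 := by
    rw [ht, inv_pow, Real.sq_sqrt hW.le, inv_mul_cancel₀ hW.ne']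
  have htb : t * b ≤ 1 := by
    have : (t * b) ^ 2 ≤ 1 := by rw [mul_pow, ← ht2]; gcongr
    nlinarith
  have hexp : Real.exp (t ^ 2 * (∫ x, g x ^ 2 ∂ν) * (2 * (1 - 1 / 3))⁻¹) ≤ 3 := by
    have h1 : t ^ 2 * (∫ x, g x ^ 2 ∂ν) * (2 * (1 - 1 / 3))⁻¹ ≤ 1 := by
      have : t ^ 2 * (∫ x, g x ^ 2 ∂ν) ≤ 1 := by rw [← ht2]; gcongr
      norm_num
      linarith
    exact ((Real.exp_le_exp.2 h1).trans Real.exp_one_lt_d9.le).trans (by norm_num)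
  have key : ∀ s : ℝ, |s| = t → ∫⁻ ω, ENNReal.ofReal
      (Real.exp (s * (pointIntegral (N ω) g - ∫ x, g x ∂ν))) ∂P ≤ 3 := by
    intro s hs
    refine (h.laplace_centered_le hg hgb (b := 1) (by rwa [hs]) (by norm_num)).trans ?_
    rw [← sq_abs s, hs]
    exact ENNReal.ofReal_le_of_le_toReal (by simpa using hexp)
  calc _ ≤ ∫⁻ ω, (ENNReal.ofReal (Real.exp (t * (pointIntegral (N ω) g - ∫ x, g x ∂ν))) +
        ENNReal.ofReal (Real.exp (-t * (pointIntegral (N ω) g - ∫ x, g x ∂ν)))) ∂P := by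
        refine lintegral_mono fun ω => ?_
        rw [← ENNReal.ofReal_add (Real.exp_pos _).le (Real.exp_pos _).le, neg_mul]
        exact ENNReal.ofReal_le_ofReal (Real.exp_abs_le _)
    _ ≤ 3 + 3 := by
        rw [lintegral_add_left']
        · exact add_le_add (key t (abs_of_pos ht0)) (key (-t) (by rw [abs_neg, abs_of_pos ht0]))
        · exact (ENNReal.measurable_ofReal.comp Real.measurable_exp).comp_aemeasurable
            (((h.aemeasurable_pointIntegral hg).sub_const _).const_mul t)
    _ = 6 := by norm_num

/-- Follows from `x ≤ exp x` at `x = |y| / (2p)`. In Hölder's inequality it bounds the `p`-norm of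
the square by an exponential moment, at the price of a factor `p²`. -/
lemma sq_le_rpow_exp_abs {p : ℝ} (hp : 0 < p) (y : ℝ) :
    y ^ 2 ≤ 4 * p ^ 2 * Real.exp |y| ^ (1 / p) := by
  have h1 : |y| / (2 * p) ≤ Real.exp (|y| / (2 * p)) :=
    (le_add_of_nonneg_right zero_le_one).trans (Real.add_one_le_exp _)
  have h2 : |y| ≤ 2 * p * Real.exp (|y| / (2 * p)) := by
    rw [div_le_iff₀ (by positivity)] at h1
    linarith
  have h3 : Real.exp |y| ^ (1 / p) = Real.exp (|y| / (2 * p)) ^ 2 := by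
    rw [← Real.exp_mul, ← Real.exp_nat_mul]
    congr 1
    field_simp
    norm_num
  rw [h3, ← sq_abs]
  calc |y| ^ 2 ≤ (2 * p * Real.exp (|y| / (2 * p))) ^ 2 := by gcongr
    _ = _ := by ring

/-- Second moment of a centred Poisson integral on an unlikely event. -/
lemma IsPoissonProcess.setLIntegral_sq_le [IsFiniteMeasure ν]
    (h : IsPoissonProcess P N ν) {g : ℝ → ℝ} (hg : Measurable g) {b W p q δ : ℝ} (hW : 0 < W)
    (hgb : ∀ᵐ x ∂ν, |g x| ≤ b) (hbW : b ^ 2 ≤ W) (hV : ∫ x, g x ^ 2 ∂ν ≤ W)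
    (hpq : p.HolderConjugate q) {A : Set Ω}
    (hδ : 0 ≤ δ) (hPA : P A ≤ ENNReal.ofReal δ) :
    ∫⁻ ω in A, ENNReal.ofReal ((pointIntegral (N ω) g - ∫ x, g x ∂ν) ^ 2) ∂P ≤
      ENNReal.ofReal (24 * p ^ 2 * W * δ ^ (1 / q)) := by
  have hp := hpq.pos
  have hq := hpq.symm.pos
  set X := fun ω => pointIntegral (N ω) g - ∫ x, g x ∂ν with hX
  set Y := fun ω => ENNReal.ofReal (Real.exp |(Real.sqrt W)⁻¹ * X ω|) with hY
  have hYm : AEMeasurable Y P :=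
    (ENNReal.measurable_ofReal.comp Real.measurable_exp).comp_aemeasurable
      (measurable_norm.comp_aemeasurable
        (((h.aemeasurable_pointIntegral hg).sub_const _).const_mul _))
  have hY6 : ∫⁻ ω, Y ω ∂P ≤ 6 := h.lintegral_exp_abs_le hg hW hgb hbW hV
  have hpt : ∀ ω, ENNReal.ofReal (X ω ^ 2) ≤
      ENNReal.ofReal (4 * p ^ 2 * W) * Y ω ^ (1 / p) := by
    intro ω
    rw [hY, ENNReal.ofReal_rpow_of_pos (Real.exp_pos _), ← ENNReal.ofReal_mul (by positivity)]
    refine ENNReal.ofReal_le_ofReal ?_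
    have := sq_le_rpow_exp_abs hp ((Real.sqrt W)⁻¹ * X ω)
    rw [mul_pow, inv_pow, Real.sq_sqrt hW.le, inv_mul_le_iff₀ hW] at this
    linarith
  have hhol := ENNReal.lintegral_mul_le_Lp_mul_Lq (P.restrict A) hpq
    (f := fun ω => Y ω ^ (1 / p)) (g := fun _ => 1) (hYm.restrict.pow_const _) aemeasurable_const
  simp only [Pi.mul_apply, mul_one, ENNReal.one_rpow, lintegral_const, one_mul,
    Measure.restrict_apply_univ, ← ENNReal.rpow_mul, one_div_mul_cancel hp.ne',
    ENNReal.rpow_one] at hhol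
  calc ∫⁻ ω in A, ENNReal.ofReal (X ω ^ 2) ∂P
      ≤ ∫⁻ ω in A, ENNReal.ofReal (4 * p ^ 2 * W) * Y ω ^ (1 / p) ∂P := lintegral_mono hpt
    _ = ENNReal.ofReal (4 * p ^ 2 * W) * ∫⁻ ω in A, Y ω ^ (1 / p) ∂P :=
        lintegral_const_mul' _ _ ENNReal.ofReal_ne_top
    _ ≤ ENNReal.ofReal (4 * p ^ 2 * W) * (6 * ENNReal.ofReal δ ^ (1 / q)) := by
        gcongr
        refine hhol.trans ?_
        gcongr
        calc (∫⁻ ω in A, Y ω ∂P) ^ (1 / p) ≤ (6 : ℝ≥0∞) ^ (1 / p) := by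
              gcongr
              exact (setLIntegral_le_lintegral _ _).trans hY6
          _ ≤ (6 : ℝ≥0∞) ^ (1 : ℝ) := by
              refine ENNReal.rpow_le_rpow_of_exponent_le (by norm_num) ?_
              rw [div_le_one hp]; exact hpq.lt.le
          _ = 6 := by simp
    _ = ENNReal.ofReal (24 * p ^ 2 * W * δ ^ (1 / q)) := by
        rw [ENNReal.ofReal_rpow_of_nonneg hδ (by positivity),
          show (6 : ℝ≥0∞) = ENNReal.ofReal 6 by simp, ← ENNReal.ofReal_mul (by norm_num),
          ← ENNReal.ofReal_mul (by positivity)]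
        congr 1; ring

lemma abs_pointIntegral_le {S : Set ℝ} (hS : S.Finite) {g : ℝ → ℝ} {b : ℝ}
    (hgb : ∀ x ∈ S, |g x| ≤ b) :
    |pointIntegral S g| ≤ b * ((S ∩ {x | g x ≠ 0}).encard.toNat : ℝ) := by
  classical
  rw [pointIntegral_eq_sum hS, ← Finset.sum_filter_ne_zero]
  have hc : (S ∩ {x | g x ≠ 0}) = (hS.toFinset.filter (fun x => g x ≠ 0) : Finset ℝ) := by
    ext x; simp
  rw [hc, Set.encard_coe_eq_coe_finsetCard, ENat.toNat_natCast, mul_comm, ← nsmul_eq_mul]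
  refine (Finset.abs_sum_le_sum_abs _ _).trans (Finset.sum_le_card_nsmul _ _ _ fun x hx => ?_)
  exact hgb x (by simpa using (Finset.mem_filter.1 hx).1)

/-- Subtracting 1 removes the event of no points, so the bound is linear in `ν D`. That linearity is
what later allows summation over `λ`. -/
lemma exists_lintegral_exp_count_sub_one_le : ∃ C : ℝ, 0 < C ∧
    ∀ {Ω : Type*} [MeasurableSpace Ω] {P : Measure Ω} [IsProbabilityMeasure P] {N : Ω → Set ℝ}
      {ν : Measure ℝ} (_ : IsPoissonProcess P N ν) {D : Set ℝ} (_ : MeasurableSet D)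
      (_ : ν D ≤ 1),
      ∫⁻ ω, ENNReal.ofReal (Real.exp (3 * ((N ω ∩ D).encard.toNat : ℝ)) - 1) ∂P ≤
        ENNReal.ofReal (C * (ν D).toReal) := by
  set a := Real.exp 3 - 1
  have ha : 0 < a := by simp [a]
  refine ⟨a * Real.exp a, by positivity, fun {Ω} _ {P} _ {N} {ν} h {D} hD hD1 => ?_⟩
  have hDt : ν D ≠ ∞ := ne_top_of_le_ne_top ENNReal.one_ne_top hD1
  set μ := (ν D).toReal
  have hμ0 : 0 ≤ μ := ENNReal.toReal_nonneg
  have hμ1 : μ ≤ 1 := ENNReal.toReal_le_of_le_ofReal zero_le_one (by simpa using hD1)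
  calc ∫⁻ ω, ENNReal.ofReal (Real.exp (3 * ((N ω ∩ D).encard.toNat : ℝ)) - 1) ∂P
      = ∫⁻ ω, (ENNReal.ofReal (Real.exp (3 * ((N ω ∩ D).encard.toNat : ℝ))) - 1) ∂P := by
        simp_rw [ENNReal.ofReal_sub _ zero_le_one, ENNReal.ofReal_one]
    _ = ENNReal.ofReal (Real.exp (μ * a)) - 1 := by
        rw [lintegral_sub measurable_const (by simp) (Filter.Eventually.of_forall fun ω => ?_),
          h.lintegral_exp_count hD hDt]
        · simp [μ, a]
        · simp only [ENNReal.one_le_ofReal]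
          exact Real.one_le_exp (by positivity)
    _ = ENNReal.ofReal (Real.exp (μ * a) - 1) := by
        rw [ENNReal.ofReal_sub _ zero_le_one, ENNReal.ofReal_one]
    _ ≤ ENNReal.ofReal (a * Real.exp a * μ) := by
        refine ENNReal.ofReal_le_ofReal ?_
        have h1 := Real.add_one_le_exp (-(μ * a))
        have h2 : Real.exp (-(μ * a)) * Real.exp (μ * a) = 1 := by
          rw [← Real.exp_add]; simp
        have h3 : Real.exp (μ * a) ≤ Real.exp a :=
          Real.exp_le_exp.2 (mul_le_of_le_one_left ha.le hμ1)
        have h4 := mul_nonneg hμ0 ha.le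
        nlinarith [Real.exp_pos (μ * a), mul_le_mul_of_nonneg_left h3 h4]

/-- Second moment of a centred Poisson integral whose support has small mean measure, on an event
where the integral is large. -/
lemma exists_setLIntegral_sq_le_of_small : ∃ C : ℝ, 0 < C ∧
    ∀ {Ω : Type*} [MeasurableSpace Ω] {P : Measure Ω} [IsProbabilityMeasure P] {N : Ω → Set ℝ}
      {ν : Measure ℝ} [IsFiniteMeasure ν] (_ : IsPoissonProcess P N ν) {g : ℝ → ℝ}
      (_ : Measurable g) {b u : ℝ} (_ : 0 < b) (_ : 0 < u) (_ : ∀ᵐ x ∂ν, |g x| ≤ b)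
      (_ : ν {x | g x ≠ 0} ≤ 1) {A : Set Ω} (_ : NullMeasurableSet A P)
      (_ : ∀ ω ∈ A, u * b ≤ |pointIntegral (N ω) g|),
      ∫⁻ ω in A, ENNReal.ofReal ((pointIntegral (N ω) g - ∫ x, g x ∂ν) ^ 2) ∂P ≤
        ENNReal.ofReal (C * b ^ 2 * (ν {x | g x ≠ 0}).toReal * Real.exp (-u)) := by
  obtain ⟨C, hC, hCle⟩ := exists_lintegral_exp_count_sub_one_le
  refine ⟨2 * C, by positivity,
    fun {Ω} _ {P} _ {N} {ν} _ h {g} hg {b u} hb hu hgb hD1 {A} hA hAu => ?_⟩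
  set D := {x | g x ≠ 0} with hDdef
  have hD : MeasurableSet D := (hg (measurableSet_singleton 0)).compl
  -- The mean is harmless because the support has mass at most 1; hence the centred integral is at
  -- most `b (k + 1) ≤ b exp k` when `k` points fall in the support.
  have hβ : |∫ x, g x ∂ν| ≤ b := by
    rw [← setIntegral_eq_integral_of_forall_compl_eq_zero (s := D)
      (fun x hx => by simpa [D] using hx)]
    have h1 := norm_setIntegral_le_of_norm_le_const_ae (μ := ν) (s := D) (f := g) (C := b)
      (measure_lt_top ν D) (ae_restrict_of_ae hgb)
    have h2 : ν.real D ≤ 1 := ENNReal.toReal_le_of_le_ofReal zero_le_one (by simpa using hD1)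
    rw [Real.norm_eq_abs] at h1
    nlinarith
  have hpt : ∀ᵐ ω ∂P, ω ∈ A → ENNReal.ofReal ((pointIntegral (N ω) g - ∫ x, g x ∂ν) ^ 2) ≤
      ENNReal.ofReal (2 * b ^ 2 * Real.exp (-u)) *
        ENNReal.ofReal (Real.exp (3 * ((N ω ∩ D).encard.toNat : ℝ)) - 1) := by
    filter_upwards [h.ae_finite, h.ae_disjoint (ae_iff.1 hgb)] with ω hfin hω hωA
    have hle := abs_pointIntegral_le hfin (g := g) (fun x hx => not_not.1 (hω x hx))
    rw [← ENNReal.ofReal_mul (by positivity)]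
    refine ENNReal.ofReal_le_ofReal ?_
    have hu' := (hAu ω hωA).trans hle
    rw [← hDdef] at hle hu'
    set k : ℕ := (N ω ∩ D).encard.toNat
    have huk : u ≤ k := by
      rw [mul_comm] at hu'
      exact le_of_mul_le_mul_left hu' hb
    have hk1 : (1 : ℝ) ≤ k := by
      have : 0 < k := by exact_mod_cast hu.trans_le huk
      exact_mod_cast this
    have hX : |pointIntegral (N ω) g - ∫ x, g x ∂ν| ≤ b * Real.exp k := by
      refine (abs_sub _ _).trans ?_
      nlinarith [Real.add_one_le_exp (k : ℝ)]
    -- Since `u ≤ k`, raising the exponent from `2k` to `3k` pays for the factor `exp (-u)`.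
    have h3 : Real.exp (k : ℝ) ^ 2 ≤ Real.exp (-u) * Real.exp (3 * k) := by
      rw [← Real.exp_nat_mul, ← Real.exp_add]
      refine Real.exp_le_exp.2 ?_
      push_cast; linarith
    have h4 : Real.exp (3 * (k : ℝ)) ≤ 2 * (Real.exp (3 * k) - 1) := by
      have := Real.add_one_le_exp (3 * (k : ℝ))
      linarith
    calc (pointIntegral (N ω) g - ∫ x, g x ∂ν) ^ 2
        = |pointIntegral (N ω) g - ∫ x, g x ∂ν| ^ 2 := (sq_abs _).symm
      _ ≤ (b * Real.exp k) ^ 2 := by gcongr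
      _ = b ^ 2 * Real.exp k ^ 2 := by ring
      _ ≤ b ^ 2 * (Real.exp (-u) * (2 * (Real.exp (3 * k) - 1))) := by
          refine mul_le_mul_of_nonneg_left (h3.trans ?_) (sq_nonneg b)
          exact mul_le_mul_of_nonneg_left h4 (Real.exp_pos _).le
      _ = 2 * b ^ 2 * Real.exp (-u) * (Real.exp (3 * k) - 1) := by ring
  calc _ ≤ ∫⁻ ω in A, ENNReal.ofReal (2 * b ^ 2 * Real.exp (-u)) *
        ENNReal.ofReal (Real.exp (3 * ((N ω ∩ D).encard.toNat : ℝ)) - 1) ∂P :=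
        lintegral_mono_ae ((ae_restrict_iff'₀ hA).2 hpt)
    _ ≤ ENNReal.ofReal (2 * b ^ 2 * Real.exp (-u)) * ENNReal.ofReal (C * (ν D).toReal) := by
        rw [lintegral_const_mul' _ _ ENNReal.ofReal_ne_top]
        gcongr
        exact (setLIntegral_le_lintegral _ _).trans (hCle h hD hD1)
    _ = _ := by
        rw [← ENNReal.ofReal_mul (by positivity)]
        congr 1; ring

end Poisson

/-! ### The mean measure and the threshold as a deviation bound. -/

lemma isFiniteMeasure_meanMeasure (n : ℕ) {f : ℝ → ℝ} (hf : Integrable f) :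
    IsFiniteMeasure (meanMeasure n f) := by
  have : IsFiniteMeasure (volume.withDensity fun x => ENNReal.ofReal (f x)) :=
    isFiniteMeasure_withDensity_ofReal hf.2
  exact Measure.smul_finite _ (ENNReal.natCast_ne_top n)

lemma meanMeasure_absolutelyContinuous (n : ℕ) (f : ℝ → ℝ) : meanMeasure n f ≪ volume :=
  (withDensity_absolutelyContinuous _ _).smul_left _

lemma integral_meanMeasure (n : ℕ) {f : ℝ → ℝ} (hf0 : ∀ x, 0 ≤ f x) (hf : Integrable f)
    (g : ℝ → ℝ) : ∫ x, g x ∂(meanMeasure n f) = n * ∫ x, f x * g x := by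
  rw [meanMeasure, integral_smul_measure, integral_withDensity_eq_integral_toReal_smul₀
    hf.1.aemeasurable.ennreal_ofReal (by simp)]
  simp [hf0]

lemma meanMeasure_apply (n : ℕ) (f : ℝ → ℝ) {D : Set ℝ} (hD : MeasurableSet D) :
    meanMeasure n f D = n * ∫⁻ x in D, ENNReal.ofReal (f x) := by
  rw [meanMeasure, Measure.smul_apply, withDensity_apply _ hD, smul_eq_mul]

lemma ae_abs_le_supNorm {g : ℝ → ℝ} (hg : eLpNorm g ∞ volume ≠ ∞) :
    ∀ᵐ x, |g x| ≤ supNorm g := by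
  rw [eLpNorm_exponent_top] at hg
  filter_upwards [ae_le_eLpNormEssSup (f := g) (μ := volume)] with x hx
  have := ENNReal.toReal_mono hg hx
  simpa [supNorm, eLpNorm_exponent_top] using this

lemma supNorm_pos {g : ℝ → ℝ} (hgm : Measurable g) (hg : eLpNorm g ∞ volume ≠ ∞)
    (hg0 : ¬ g =ᵐ[volume] 0) : 0 < supNorm g :=
  ENNReal.toReal_pos (by rwa [Ne, eLpNorm_eq_zero_iff hgm.aestronglyMeasurable (by simp)]) hg

lemma coeffHat_eq (n : ℕ) (S : Set ℝ) (g : ℝ → ℝ) :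
    coeffHat n S g = pointIntegral S (fun x => 1 / (n : ℝ) * g x) := by
  rw [coeffHat, pointIntegral_const_mul]

lemma varHat_eq (n : ℕ) (S : Set ℝ) (g : ℝ → ℝ) :
    varHat n S g = pointIntegral S (fun x => (1 / (n : ℝ) * g x) ^ 2) := by
  rw [varHat]
  congr 1; ext x; ring

lemma threshold_eq (γ : ℝ) (n : ℕ) (S : Set ℝ) (g : ℝ → ℝ) :
    threshold γ n S g = devBound (γ * Real.log n)
      (pointIntegral S (fun x => (1 / (n : ℝ) * g x) ^ 2)) (1 / (n : ℝ) * supNorm g) := by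
  rw [threshold, devBound, varTilde, varHat_eq]
  congr 1
  · congr 1
    rw [show ∀ v : ℝ, 2 * (γ * Real.log n) * v * (1 / (n : ℝ) * supNorm g) ^ 2 =
      2 * γ * Real.log n * v * (supNorm g ^ 2 / (n : ℝ) ^ 2) by intro v; ring]
    ring
  · ring

lemma mul_le_devBound {u V b : ℝ} (hu : 0 ≤ u) (hV : 0 ≤ V) (hb : 0 ≤ b) :
    u * b ≤ devBound u V b := by
  have h1 : u * b ≤ Real.sqrt (2 * u * (V + Real.sqrt (2 * u * V * b ^ 2) + 3 * u * b ^ 2)) := by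
    refine Real.le_sqrt_of_sq_le ?_
    have : 0 ≤ u * V := by positivity
    have : 0 ≤ u * Real.sqrt (2 * u * V * b ^ 2) := by positivity
    nlinarith [sq_nonneg (u * b)]
  unfold devBound
  have : 0 ≤ u * b / 3 := by positivity
  linarith

/-- Shrinking the threshold by `k` costs only a change of level from `u` to `k² u`. With `k² =
1/(1+ε)` and `u = γ ln n` this gives the power `n^(-γ/(1+ε))`. -/
lemma devBound_sq_mul_le {k u V b : ℝ} (hk : 0 ≤ k) (hk1 : k ≤ 1) (hu : 0 ≤ u) (hV : 0 ≤ V)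
    (hb : 0 ≤ b) : devBound (k ^ 2 * u) V b ≤ k * devBound u V b := by
  have hk2 : k ^ 2 * u ≤ u := mul_le_of_le_one_left hu (pow_le_one₀ hk hk1)
  have hk3 : k ^ 2 ≤ k := by nlinarith
  unfold devBound
  rw [mul_add k]
  refine add_le_add ?_ ?_
  · calc _ ≤ Real.sqrt (k ^ 2 * (2 * u * (V + Real.sqrt (2 * u * V * b ^ 2) + 3 * u * b ^ 2))) := by
          refine Real.sqrt_le_sqrt ?_
          rw [show 2 * (k ^ 2 * u) * (V + Real.sqrt (2 * (k ^ 2 * u) * V * b ^ 2) +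
            3 * (k ^ 2 * u) * b ^ 2) = k ^ 2 * (2 * u * (V +
            Real.sqrt (2 * (k ^ 2 * u) * V * b ^ 2) + 3 * (k ^ 2 * u) * b ^ 2)) by ring]
          gcongr
      _ = _ := by rw [Real.sqrt_mul (sq_nonneg k), Real.sqrt_sq hk]
  · have : 0 ≤ u * b := by positivity
    nlinarith

lemma aemeasurable_devBound {Ω : Type*} [MeasurableSpace Ω] {P : Measure Ω} {V : Ω → ℝ}
    (hV : AEMeasurable V P) (u b : ℝ) : AEMeasurable (fun ω => devBound u (V ω) b) P := by
  unfold devBound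
  exact (by fun_prop : Measurable fun V : ℝ => Real.sqrt (2 * u *
    (V + Real.sqrt (2 * u * V * b ^ 2) + 3 * u * b ^ 2)) + u * b / 3).comp_aemeasurable hV

section Poisson

variable {Ω : Type*} [MeasurableSpace Ω] {P : Measure Ω} {N : Ω → Set ℝ} {n : ℕ} {f : ℝ → ℝ}

lemma IsPoissonProcess.aemeasurable_coeffHat (h : IsPoissonProcess P N (meanMeasure n f))
    (hf : Integrable f) {g : ℝ → ℝ} (hg : Measurable g) :
    AEMeasurable (fun ω => coeffHat n (N ω) g) P := by
  have := isFiniteMeasure_meanMeasure n hf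
  simp_rw [coeffHat_eq]
  exact h.aemeasurable_pointIntegral (hg.const_mul _)

lemma IsPoissonProcess.aemeasurable_threshold (h : IsPoissonProcess P N (meanMeasure n f))
    (hf : Integrable f) {g : ℝ → ℝ} (hg : Measurable g) (γ : ℝ) :
    AEMeasurable (fun ω => threshold γ n (N ω) g) P := by
  have := isFiniteMeasure_meanMeasure n hf
  simp_rw [threshold_eq]
  exact aemeasurable_devBound (h.aemeasurable_pointIntegral ((hg.const_mul _).pow_const 2)) _ _

end Poisson

/-! ### The bad event of one coefficient. -/

/-- The event where the coefficient is kept although it deviates by more than `k` times the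
threshold. -/
def badEvent {Ω : Type*} (N : Ω → Set ℝ) (n : ℕ) (f g : ℝ → ℝ) (γ k : ℝ) : Set Ω :=
  {ω | k * threshold γ n (N ω) g < |coeffHat n (N ω) g - coeff f g| ∧
    threshold γ n (N ω) g ≤ |coeffHat n (N ω) g|}

lemma IsPoissonProcess.nullMeasurableSet_badEvent {Ω : Type*} [MeasurableSpace Ω]
    {P : Measure Ω} {N : Ω → Set ℝ} {n : ℕ} {f : ℝ → ℝ}
    (h : IsPoissonProcess P N (meanMeasure n f))
    (hf : Integrable f) {g : ℝ → ℝ} (hg : Measurable g) (γ k : ℝ) :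
    NullMeasurableSet (badEvent N n f g γ k) P := by
  have h1 := h.aemeasurable_coeffHat hf hg
  have h2 := h.aemeasurable_threshold hf hg γ
  exact (nullMeasurableSet_lt (h2.const_mul k)
    (measurable_norm.comp_aemeasurable (h1.sub_const _))).inter
    (nullMeasurableSet_le h2 (measurable_norm.comp_aemeasurable h1))

/-- The contribution of a single coefficient to the remainder. -/
lemma exists_setLIntegral_badEvent_le : ∃ C : ℝ, 0 < C ∧
    ∀ {Ω : Type*} [MeasurableSpace Ω] {P : Measure Ω} [IsProbabilityMeasure P] {N : Ω → Set ℝ}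
      {n : ℕ} {f g : ℝ → ℝ} {c γ ε p q : ℝ} (_ : 2 ≤ n) (_ : ∀ x, 0 ≤ f x) (_ : Integrable f)
      (_ : IsPoissonProcess P N (meanMeasure n f)) (_ : Measurable g)
      (_ : ¬ g =ᵐ[volume] 0) (_ : eLpNorm g ∞ volume ≤ ENNReal.ofReal (c * Real.sqrt n))
      (_ : 1 < γ) (_ : 0 < ε) (_ : p.HolderConjugate q),
      ∫⁻ ω in badEvent N n f g γ (Real.sqrt (1 / (1 + ε))),
        ENNReal.ofReal ((coeffHat n (N ω) g - coeff f g) ^ 2) ∂P ≤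
      ENNReal.ofReal (C * p ^ 2 * c ^ 2 *
        ((n : ℝ) ^ (-(γ / (q * (1 + ε)))) + (n : ℝ) ^ (-(γ / q)))) *
        ∫⁻ x in {x | g x ≠ 0}, ENNReal.ofReal (f x) := by
  obtain ⟨C, hC, hsmall⟩ := exists_setLIntegral_sq_le_of_small
  refine ⟨72 + C, by positivity, ?_⟩
  intro Ω _ P _ N n f g c γ ε p q hn hf0 hf hN hg hg0 hgc hγ hε hpq
  have hfin := isFiniteMeasure_meanMeasure n hf
  set ν := meanMeasure n f with hν
  have hp1 := hpq.lt
  have hq1 := hpq.symm.lt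
  have hn0 : (0 : ℝ) < n := by exact_mod_cast (by omega : 0 < n)
  have hn1 : (1 : ℝ) < n := by exact_mod_cast (by omega : 1 < n)
  have hlog : 0 < Real.log n := Real.log_pos hn1
  have hgtop : eLpNorm g ∞ volume ≠ ∞ := ne_top_of_le_ne_top ENNReal.ofReal_ne_top hgc
  have hB := supNorm_pos hg hgtop hg0
  have hc0 : 0 < c * Real.sqrt n := by
    by_contra! hneg
    rw [ENNReal.ofReal_of_nonpos hneg, nonpos_iff_eq_zero] at hgc
    simp [supNorm, hgc] at hB
  have hBc : supNorm g ≤ c * Real.sqrt n := ENNReal.toReal_le_of_le_ofReal hc0.le hgc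
  have hc : 0 < c := pos_of_mul_pos_left hc0 (Real.sqrt_nonneg _)
  set b := 1 / (n : ℝ) * supNorm g with hb
  have hb0 : 0 < b := by positivity
  have hbc : b ^ 2 * n ≤ c ^ 2 := by
    have h1 : supNorm g ^ 2 ≤ c ^ 2 * n := by
      calc supNorm g ^ 2 ≤ (c * Real.sqrt n) ^ 2 := by gcongr
        _ = c ^ 2 * n := by rw [mul_pow, Real.sq_sqrt hn0.le]
    rw [hb, mul_pow, show (1 / (n : ℝ)) ^ 2 * supNorm g ^ 2 * n = supNorm g ^ 2 / n by
      field_simp, div_le_iff₀ hn0]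
    exact h1
  set G : ℝ → ℝ := fun x => 1 / (n : ℝ) * g x with hG
  have hGm : Measurable G := hg.const_mul _
  have hGb : ∀ᵐ x ∂ν, |G x| ≤ b := by
    filter_upwards [(meanMeasure_absolutelyContinuous n f).ae_le (ae_abs_le_supNorm hgtop)]
      with x hx
    rw [hG, hb, abs_mul, abs_of_pos (by positivity : 0 < 1 / (n : ℝ))]
    gcongr
  have hβ : ∫ x, G x ∂ν = coeff f g := by
    rw [hν, integral_meanMeasure n hf0 hf, hG, coeff, ← integral_const_mul]
    congr 1; ext x; field_simp
  set D := {x | g x ≠ 0} with hD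
  have hDm : MeasurableSet D := (hg (measurableSet_singleton 0)).compl
  have hDG : {x | G x ≠ 0} = D := by
    ext x; simp [hG, hD, hn0.ne']
  set I := ∫⁻ x in D, ENNReal.ofReal (f x) with hI
  have hνD : ν D = n * I := meanMeasure_apply n f hDm
  have hItop : I ≠ ∞ := by
    intro hcon
    refine measure_ne_top ν D ?_
    rw [hνD, hcon, ENNReal.mul_top (by exact_mod_cast (by omega : n ≠ 0))]
  set F := I.toReal with hF
  have hIF : I = ENNReal.ofReal F := (ENNReal.ofReal_toReal hItop).symm
  have hF0 : 0 ≤ F := ENNReal.toReal_nonneg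
  have hνF : (ν D).toReal = n * F := by rw [hνD, ENNReal.toReal_mul]; simp [hF]
  set u := γ * Real.log n with hu
  have hu0 : 0 < u := by positivity
  set k := Real.sqrt (1 / (1 + ε)) with hk
  have hk2 : k ^ 2 = 1 / (1 + ε) := Real.sq_sqrt (by positivity)
  have hk0 : 0 ≤ k := Real.sqrt_nonneg _
  have hk1 : k ≤ 1 := by
    rw [hk, Real.sqrt_le_one, div_le_one (by positivity)]
    linarith
  set A := badEvent N n f g γ k with hA
  have hAm : NullMeasurableSet A P := hN.nullMeasurableSet_badEvent hf hg γ k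
  have hVhat : ∀ ω, 0 ≤ pointIntegral (N ω) (fun x => G x ^ 2) :=
    fun ω => pointIntegral_nonneg _ fun x => sq_nonneg _
  have hexp : ∀ a : ℝ, Real.exp (-(a * Real.log n)) = (n : ℝ) ^ (-a) := fun a => by
    rw [Real.rpow_def_of_pos hn0]; congr 1; ring
  simp_rw [coeffHat_eq]
  rw [← hβ, hIF, ← ENNReal.ofReal_mul (by positivity)]
  have hr1 : 0 ≤ (n : ℝ) ^ (-(γ / (q * (1 + ε)))) := by positivity
  have hr2 : 0 ≤ (n : ℝ) ^ (-(γ / q)) := by positivity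
  have hp2 : 1 ≤ p ^ 2 := one_le_pow₀ hp1.le
  -- The second-moment bound needs a scale `W` above both the variance and `b²`. The choice `W = c²
  -- F` qualifies when `nF ≥ 1`, because `b² n ≤ c²`; otherwise the small-support estimate is used.
  rcases le_or_gt 1 (n * F) with hcase | hcase
  · have hFpos : 0 < F := by
      by_contra! h0
      have := mul_nonpos_of_nonneg_of_nonpos hn0.le h0
      linarith
    have hV : ∫ x, G x ^ 2 ∂ν ≤ c ^ 2 * F := by
      have h1 : ∫ x, G x ^ 2 ∂ν = ∫ x in D, G x ^ 2 ∂ν := by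
        rw [setIntegral_eq_integral_of_forall_compl_eq_zero]
        intro x hx
        have : g x = 0 := by simpa [hD] using hx
        simp [hG, this]
      have h2 := norm_setIntegral_le_of_norm_le_const_ae (μ := ν) (s := D)
        (f := fun x => G x ^ 2) (C := b ^ 2) (measure_lt_top ν D) (ae_restrict_of_ae (ae_sq_le hGb))
      rw [← h1, measureReal_def, hνF] at h2
      calc _ ≤ b ^ 2 * (n * F) := (le_abs_self _).trans h2
        _ = b ^ 2 * n * F := by ring
        _ ≤ c ^ 2 * F := by gcongr
    have hVpos : 0 < ∫ x, G x ^ 2 ∂ν := by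
      rw [integral_pos_iff_support_of_nonneg (fun x => sq_nonneg _)
        (integrable_of_ae_abs_le (hGm.pow_const 2) (ae_sq_le hGb))]
      have : Function.support (fun x => G x ^ 2) = D := by
        rw [← hDG]; ext x; simp
      rw [this]
      refine (ENNReal.toReal_pos_iff.1 ?_).1
      rw [hνF]; positivity
    have hbW : b ^ 2 ≤ c ^ 2 * F := by
      calc b ^ 2 ≤ b ^ 2 * (n * F) := le_mul_of_one_le_right (sq_nonneg b) hcase
        _ = b ^ 2 * n * F := by ring
        _ ≤ c ^ 2 * F := by gcongr
    have hPA : P A ≤ ENNReal.ofReal (3 * (n : ℝ) ^ (-(γ / (1 + ε)))) := by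
      have hdev := hN.deviation hGm (u := k ^ 2 * u) hb0 hGb hVpos (by positivity)
      rw [hk2, hu, show 1 / (1 + ε) * (γ * Real.log n) = γ / (1 + ε) * Real.log n by ring,
        hexp] at hdev
      refine (measure_mono fun ω hω => ?_).trans hdev
      have h1 := hω.1
      rw [threshold_eq, coeffHat_eq, ← hβ] at h1
      have h2 := devBound_sq_mul_le hk0 hk1 hu0.le (hVhat ω) hb0.le
      rw [hk2, hu, show 1 / (1 + ε) * (γ * Real.log n) = γ / (1 + ε) * Real.log n by ring] at h2
      exact h2.trans_lt h1
    refine (hN.setLIntegral_sq_le hGm (by positivity) hGb hbW hV hpq (by positivity) hPA).trans ?_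
    refine ENNReal.ofReal_le_ofReal ?_
    have h3 : (3 * (n : ℝ) ^ (-(γ / (1 + ε)))) ^ (1 / q) ≤
        3 * (n : ℝ) ^ (-(γ / (q * (1 + ε)))) := by
      rw [Real.mul_rpow (by norm_num) (by positivity), ← Real.rpow_mul hn0.le]
      have h4 : (3 : ℝ) ^ (1 / q) ≤ 3 := by
        calc (3 : ℝ) ^ (1 / q) ≤ 3 ^ (1 : ℝ) := by
              refine Real.rpow_le_rpow_of_exponent_le (by norm_num) ?_
              rw [div_le_one (by linarith)]; exact hq1.le
          _ = 3 := by simp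
      have h5 : -(γ / (1 + ε)) * (1 / q) = -(γ / (q * (1 + ε))) := by
        field_simp
      rw [h5]
      gcongr
    calc 24 * p ^ 2 * (c ^ 2 * F) * (3 * (n : ℝ) ^ (-(γ / (1 + ε)))) ^ (1 / q)
        ≤ 24 * p ^ 2 * (c ^ 2 * F) * (3 * (n : ℝ) ^ (-(γ / (q * (1 + ε))))) := by gcongr
      _ = 72 * p ^ 2 * c ^ 2 * ((n : ℝ) ^ (-(γ / (q * (1 + ε)))) + 0) * F := by ring
      _ ≤ (72 + C) * p ^ 2 * c ^ 2 *
          ((n : ℝ) ^ (-(γ / (q * (1 + ε)))) + (n : ℝ) ^ (-(γ / q))) * F := by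
        gcongr
        linarith
  · have hAu : ∀ ω ∈ A, u * b ≤ |pointIntegral (N ω) G| := by
      intro ω hω
      have h1 := hω.2
      rw [threshold_eq, coeffHat_eq] at h1
      exact (mul_le_devBound hu0.le (hVhat ω) hb0.le).trans h1
    have hD1 : ν {x | G x ≠ 0} ≤ 1 := by
      rw [hDG, ← ENNReal.ofReal_toReal (measure_ne_top ν D), hνF, ENNReal.ofReal_le_one]
      exact hcase.le
    refine (hsmall hN hGm hb0 hu0 hGb hD1 hAm hAu).trans (ENNReal.ofReal_le_ofReal ?_)
    rw [hDG, hνF, hu, hexp]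
    have h3 : (n : ℝ) ^ (-γ) ≤ (n : ℝ) ^ (-(γ / q)) := by
      refine Real.rpow_le_rpow_of_exponent_le hn1.le (neg_le_neg ?_)
      exact div_le_self (by linarith) hq1.le
    calc C * b ^ 2 * (n * F) * (n : ℝ) ^ (-γ) = C * 1 * (b ^ 2 * n) * (0 + (n : ℝ) ^ (-γ)) * F := by
          ring
      _ ≤ (72 + C) * p ^ 2 * c ^ 2 *
          ((n : ℝ) ^ (-(γ / (q * (1 + ε)))) + (n : ℝ) ^ (-(γ / q))) * F := by
        gcongr
        linarith

/-! ### Deterministic thresholding inequalities and the pathwise oracle bound. -/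

/-- If the coefficient is discarded, `|y| ≤ |x - y| + η`, and Young's inequality splits the square
with the weights shown. If it is kept, the first term alone suffices. -/
lemma thresholded_sq_le_dev {ε η x y : ℝ} (hε : 0 < ε) {z : ℝ}
    (hz : η ≤ |x| ∧ z = x ∨ |x| < η ∧ z = 0) :
    ε / (2 + ε) * (z - y) ^ 2 ≤ ε * (x - y) ^ 2 + η ^ 2 := by
  rw [div_mul_eq_mul_div, div_le_iff₀ (by positivity)]
  rcases hz with ⟨_, rfl⟩ | ⟨h, rfl⟩
  · nlinarith [mul_nonneg hε.le (sq_nonneg (z - y)), sq_nonneg η,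
      mul_nonneg hε.le (mul_nonneg hε.le (sq_nonneg (z - y)))]
  · have h1 : |y| ≤ |x - y| + η := by
      have := abs_sub_abs_le_abs_sub y x
      rw [abs_sub_comm] at this
      linarith
    have h2 : y ^ 2 ≤ (|x - y| + η) ^ 2 := by
      rw [← sq_abs y]; gcongr
    rw [← sq_abs (x - y)]
    have hη : 0 < η := (abs_nonneg x).trans_lt h
    set e := |x - y|
    have h3 := mul_le_mul_of_nonneg_left h2 hε.le
    nlinarith [sq_nonneg (ε * e - 2 * η), mul_nonneg hε.le (sq_nonneg e),
      mul_nonneg hε.le (mul_nonneg hε.le (sq_nonneg e))]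

/-- For a kept coefficient, `|x - y| ≤ k η ≤ k |x|` with `k² = 1/(1+ε)`, so the triangle inequality
absorbs `x` and gives `|x - y| ≤ (1 + 2/ε) |y|`. The prefactor `ε/(2+ε)` cancels one of the two
factors `1 + 2/ε` produced by squaring. -/
lemma thresholded_sq_le_bias {ε η x y : ℝ} (hε : 0 < ε) {z : ℝ}
    (hz : η ≤ |x| ∧ z = x ∨ |x| < η ∧ z = 0)
    (hgood : η ≤ |x| → |x - y| ≤ Real.sqrt (1 / (1 + ε)) * η) :
    ε / (2 + ε) * (z - y) ^ 2 ≤ (1 + 2 / ε) * y ^ 2 := by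
  have ha : 1 + 2 / ε = (2 + ε) / ε := by field_simp; ring
  rw [ha, div_mul_eq_mul_div, div_mul_eq_mul_div, div_le_div_iff₀ (by positivity) hε]
  suffices h : ε * |z - y| ≤ (2 + ε) * |y| by
    have := mul_self_le_mul_self (by positivity) h
    have e1 := abs_mul_abs_self (z - y)
    have e2 := abs_mul_abs_self y
    calc ε * (z - y) ^ 2 * ε = ε * |z - y| * (ε * |z - y|) := by
          rw [sq, ← e1]; ring
      _ ≤ (2 + ε) * |y| * ((2 + ε) * |y|) := this
      _ = (2 + ε) * y ^ 2 * (2 + ε) := by rw [sq y, ← e2]; ring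
  rcases hz with ⟨h, rfl⟩ | ⟨_, rfl⟩
  · have h1 := hgood h
    set k := Real.sqrt (1 / (1 + ε)) with hk
    have hk2 : k ^ 2 * (1 + ε) = 1 := by
      rw [hk, Real.sq_sqrt (by positivity)]; field_simp
    have hk0 : 0 < k := by rw [hk]; positivity
    have hk1 : k ≤ 1 := by
      rw [hk, Real.sqrt_le_one, div_le_one (by positivity)]; linarith
    have h2 : |z| ≤ |z - y| + |y| := by
      have := abs_add_le (z - y) y
      rwa [sub_add_cancel] at this
    have h3 : (1 - k) * |z - y| ≤ k * |y| := by
      have := mul_le_mul_of_nonneg_left (h.trans h2) hk0.le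
      linarith
    have h4 : (1 - k ^ 2) * |z - y| ≤ (1 + k ^ 2) * |y| := by
      have := mul_le_mul_of_nonneg_left h3 (show 0 ≤ 1 + k by linarith)
      have h5 : k * |y| ≤ 1 * |y| := by gcongr
      linarith
    have h6 := mul_le_mul_of_nonneg_left h4 (show 0 ≤ 1 + ε by linarith)
    have e1 : (1 + ε) * ((1 - k ^ 2) * |z - y|) = ε * |z - y| := by
      linear_combination -|z - y| * hk2
    have e2 : (1 + ε) * ((1 + k ^ 2) * |y|) = (2 + ε) * |y| := by
      linear_combination |y| * hk2
    rwa [e1, e2] at h6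
  · rw [zero_sub, abs_neg]
    gcongr
    linarith

lemma coeffTilde_cases (γ : ℝ) (n : ℕ) (S : Set ℝ) (g : ℝ → ℝ) :
    threshold γ n S g ≤ |coeffHat n S g| ∧ coeffTilde γ n S g = coeffHat n S g ∨
      |coeffHat n S g| < threshold γ n S g ∧ coeffTilde γ n S g = 0 := by
  unfold coeffTilde
  split_ifs with h
  · exact Or.inl ⟨h, rfl⟩
  · exact Or.inr ⟨not_le.1 h, rfl⟩

lemma coeffTilde_eq_zero {γ : ℝ} {n : ℕ} {S : Set ℝ} {g : ℝ → ℝ} (h : ∀ x ∈ S, g x = 0) :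
    coeffTilde γ n S g = 0 := by
  have h0 : coeffHat n S g = 0 := by
    rw [coeffHat, pointIntegral_congr (g' := fun _ => 0) h, pointIntegral, tsum_zero, mul_zero]
  rcases coeffTilde_cases γ n S g with h' | h'
  · rw [h'.2, h0]
  · exact h'.2

/-- Squared error on the bad event of a coefficient. -/
noncomputable def badError {Ω : Type*} (N : Ω → Set ℝ) (n : ℕ) (f g : ℝ → ℝ) (γ ε : ℝ) : Ω → ℝ≥0∞ :=
  (badEvent N n f g γ (Real.sqrt (1 / (1 + ε)))).indicator
    fun ω => ENNReal.ofReal ((coeffHat n (N ω) g - coeff f g) ^ 2)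

/-- Pathwise oracle inequality for the thresholded coefficients. -/
lemma phiNormSq_le_criterion {Λ Ω : Type*} (N : Ω → Set ℝ) (φ : Λ → ℝ → ℝ) (f : ℝ → ℝ)
    (Γ : Set Λ) {γ ε : ℝ} (n : ℕ) (hε : 0 < ε) (ω : Ω) {M : Set Λ} (hM : M ⊆ Γ) :
    ENNReal.ofReal (ε / (2 + ε)) * phiNormSq (errorCoeff φ Γ f γ n (N ω)) ≤
      criterion φ f γ ε n (N ω) M + ∑' l : Γ, badError N n f (φ l) γ ε ω := by
  classical
  have hlow : ε / (2 + ε) ≤ 1 := by rw [div_le_one (by positivity)]; linarith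
  have hbig : 1 ≤ 1 + 2 / ε := le_add_of_nonneg_right (by positivity)
  rw [phiNormSq, criterion, tsum_subtype Γ (fun l => badError N n f (φ l) γ ε ω),
    tsum_subtype Mᶜ (fun l => ENNReal.ofReal (coeff f (φ l) ^ 2)),
    tsum_subtype M (fun l => ENNReal.ofReal ((coeffHat n (N ω) (φ l) - coeff f (φ l)) ^ 2)),
    tsum_subtype M (fun l => ENNReal.ofReal (threshold γ n (N ω) (φ l) ^ 2)),
    ← ENNReal.tsum_mul_left, ← ENNReal.tsum_mul_left, ← ENNReal.tsum_mul_left,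
    ← ENNReal.tsum_add, ← ENNReal.tsum_add, ← ENNReal.tsum_add]
  refine ENNReal.tsum_le_tsum fun l => ?_
  rw [← ENNReal.ofReal_mul (by positivity)]
  have hz := coeffTilde_cases γ n (N ω) (φ l)
  by_cases hlM : l ∈ M
  · have hlG := hM hlM
    simp only [errorCoeff, Set.indicator_of_mem hlM, Set.indicator_of_mem hlG,
      Set.indicator_of_notMem (Set.notMem_compl_iff.2 hlM), mul_zero, zero_add]
    refine le_add_right ?_
    rw [← ENNReal.ofReal_mul hε.le, ← ENNReal.ofReal_add (by positivity) (by positivity)]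
    exact ENNReal.ofReal_le_ofReal (thresholded_sq_le_dev hε hz)
  · simp only [Set.indicator_of_notMem hlM, Set.indicator_of_mem (Set.mem_compl hlM), mul_zero,
      add_zero]
    rw [← ENNReal.ofReal_mul (by positivity)]
    by_cases hlG : l ∈ Γ
    · simp only [errorCoeff, Set.indicator_of_mem hlG]
      by_cases hbad : ω ∈ badEvent N n f (φ l) γ (Real.sqrt (1 / (1 + ε)))
      · refine le_add_left ?_
        rw [badError, Set.indicator_of_mem hbad]
        refine ENNReal.ofReal_le_ofReal ?_
        rcases hz with hz | hz
        · rw [hz.2]; exact mul_le_of_le_one_left (sq_nonneg _) hlow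
        · exact absurd hbad.2 (not_le.2 hz.1)
      · refine le_add_right (ENNReal.ofReal_le_ofReal (thresholded_sq_le_bias hε hz fun h => ?_))
        by_contra! hlt
        exact hbad ⟨hlt, h⟩
    · refine le_add_right (ENNReal.ofReal_le_ofReal ?_)
      rw [errorCoeff, Set.indicator_of_notMem hlG, zero_sub, neg_sq]
      exact mul_le_mul_of_nonneg_right (hlow.trans hbig) (sq_nonneg _)

/-! ### Summation over the selected family. -/

lemma tsum_measure_ne_zero_le {Λ : Type*} {φ : Λ → ℝ → ℝ} (hφ : ∀ l, Measurable (φ l))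
    {Γ : Set Λ} {K : ℝ} (hK : ∀ x : ℝ, {l ∈ Γ | φ l x ≠ 0}.Finite ∧
      ({l ∈ Γ | φ l x ≠ 0}.ncard : ℝ) ≤ K) (ρ : Measure ℝ) :
    ∑' l : Γ, ρ {x | φ l x ≠ 0} ≤ ENNReal.ofReal K * ρ Set.univ := by
  classical
  refine ENNReal.summable.tsum_le_of_sum_le fun s => ?_
  have hmeas : ∀ l, MeasurableSet {x | φ l x ≠ 0} := fun l =>
    (hφ l (measurableSet_singleton 0)).compl
  calc ∑ l ∈ s, ρ {x | φ l x ≠ 0}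
      = ∑ l ∈ s, ∫⁻ x, {x | φ l x ≠ 0}.indicator 1 x ∂ρ := by
        simp_rw [lintegral_indicator_one (hmeas _)]
    _ = ∫⁻ x, ∑ l ∈ s, {x | φ l x ≠ 0}.indicator 1 x ∂ρ :=
        (lintegral_finsetSum s fun (l : Γ) _ => measurable_one.indicator (hmeas l)).symm
    _ ≤ ∫⁻ _, ENNReal.ofReal K ∂ρ := by
        refine lintegral_mono fun x => ?_
        have h1 : (∑ l ∈ s, {x | φ l x ≠ 0}.indicator (1 : ℝ → ℝ≥0∞) x) =
            ((s.filter fun l : Γ => φ l x ≠ 0).card : ℝ≥0∞) := by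
          simp [Set.indicator_apply, Finset.sum_ite]
        have h2 : (s.filter fun l : Γ => φ l x ≠ 0).card ≤ {l ∈ Γ | φ l x ≠ 0}.ncard := by
          rw [← Set.ncard_coe_finset, ← Set.ncard_image_of_injective _ Subtype.val_injective]
          refine Set.ncard_le_ncard ?_ (hK x).1
          rintro _ ⟨l, hl, rfl⟩
          exact ⟨l.2, by simpa using (Finset.mem_filter.1 hl).2⟩
        simp only [h1]
        rw [← ENNReal.ofReal_natCast]
        exact ENNReal.ofReal_le_ofReal ((Nat.cast_le.2 h2).trans (hK x).2)
    _ = ENNReal.ofReal K * ρ Set.univ := lintegral_const _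

/-- Against a finite measure with the same null sets as Lebesgue measure, the sets where the `φ l`
do not vanish have finite total mass, while each has positive mass. A convergent sum has only
countably many nonzero terms. -/
lemma countable_of_overlap_bounded {Λ : Type*} {φ : Λ → ℝ → ℝ} (hφ : ∀ l, Measurable (φ l))
    {Γ : Set Λ} {K : ℝ} (hK : ∀ x : ℝ, {l ∈ Γ | φ l x ≠ 0}.Finite ∧
      ({l ∈ Γ | φ l x ≠ 0}.ncard : ℝ) ≤ K) (h0 : ∀ l, ¬ φ l =ᵐ[volume] 0) : Γ.Countable := by
  have h1 := tsum_measure_ne_zero_le hφ hK (volume : Measure ℝ).toFinite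
  have h2 := Summable.countable_support_ennreal
    (ne_top_of_le_ne_top (ENNReal.mul_ne_top ENNReal.ofReal_ne_top (measure_ne_top _ _)) h1)
  have h3 : (Function.support fun l : Γ => (volume : Measure ℝ).toFinite {x | φ l x ≠ 0}) =
      Set.univ := by
    refine Set.eq_univ_of_forall fun l hl => h0 l ?_
    exact absolutelyContinuous_toFinite (volume : Measure ℝ) hl
  rw [h3, Set.countable_univ_iff] at h2
  exact Set.countable_coe_iff.1 h2

/-- Only functions that are nonzero at some observed point can have a nonzero thresholded
coefficient. With finitely many points and finite overlap, the estimator is a finite sum. -/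
lemma hasSum_errorCoeff {Λ : Type*} {f : ℝ → ℝ} (hf : MemLp f 2 volume)
    {φ : Λ → ℝ → ℝ} {φt : Λ → Lp ℝ 2 (volume : Measure ℝ)} {Γ : Set Λ} (γ : ℝ) (n : ℕ)
    (hsum : HasSum (fun l => coeff f (φ l) • φt l) (hf.toLp f)) {S : Set ℝ} (hS : S.Finite)
    (hloc : ∀ x : ℝ, {l ∈ Γ | φ l x ≠ 0}.Finite) :
    HasSum (fun l => errorCoeff φ Γ f γ n S l • φt l)
      (estimator φ φt Γ γ n S - hf.toLp f) := by
  have hT : (⋃ x ∈ S, {l ∈ Γ | φ l x ≠ 0}).Finite := hS.biUnion fun x _ => hloc x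
  have hs : Summable fun l : Γ => coeffTilde γ n S (φ l) • φt l := by
    refine summable_of_hasFiniteSupport ((hT.preimage Subtype.val_injective.injOn).subset ?_)
    intro l hl
    by_contra hlT
    refine hl ?_
    have : coeffTilde γ n S (φ l) = 0 := by
      refine coeffTilde_eq_zero fun x hx => ?_
      by_contra hne
      exact hlT (Set.mem_preimage.2 (Set.mem_biUnion hx ⟨l.2, hne⟩))
    simp [this]
  have h1 := (hasSum_subtype_iff_indicator (f := fun l => coeffTilde γ n S (φ l) • φt l)).1
    hs.hasSum
  convert! h1.sub hsum using 1
  ext1 l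
  rw [errorCoeff, sub_smul]
  by_cases hl : l ∈ Γ <;> simp [hl]

end PoissonThreshold

/-! ### The oracle inequality. -/

theorem theorem1 :
    ∃ c₀ : ℝ, 0 < c₀ ∧
      ∀ (Λ : Type*) (Ω : Type*) [MeasurableSpace Ω] (P : Measure Ω) [IsProbabilityMeasure P]
        (n : ℕ) (f : ℝ → ℝ) (N : Ω → Set ℝ)
        (φ : Λ → ℝ → ℝ) (φt : Λ → Lp ℝ 2 (volume : Measure ℝ)) (Γ : Set Λ) (c m γ ε p q : ℝ)
        (_ : 1 ≤ n)
        (_ : ∀ x, 0 ≤ f x) (_ : Integrable f) (hf : MemLp f 2)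
        (_ : IsPoissonProcess P N (meanMeasure n f))
        (_ : ∀ l, Measurable (φ l)) (hφ : ∀ l, MemLp (φ l) 2)
        (_ : LinearIndependent ℝ fun l => (hφ l).toLp (φ l)) (_ : LinearIndependent ℝ φt)
        (_ : HasSum (fun l => coeff f (φ l) • φt l) (hf.toLp f))
        (_ : ∀ l ∈ Γ, eLpNorm (φ l) ∞ volume ≤ ENNReal.ofReal (c * Real.sqrt n))
        (_ : ∀ x : ℝ, {l ∈ Γ | φ l x ≠ 0}.Finite ∧
          ({l ∈ Γ | φ l x ≠ 0}.ncard : ℝ) ≤ m * Real.log n)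
        (_ : 1 < γ) (_ : 0 < ε) (_ : ε < γ - 1)
        (_ : 2 ≤ p) (_ : 1 / p + 1 / q = 1) (_ : 1 + ε < γ / q),
        (∀ᵐ ω ∂P, HasSum (fun l => errorCoeff φ Γ f γ n (N ω) l • φt l)
          (estimator φ φt Γ γ n (N ω) - hf.toLp f)) ∧
        ENNReal.ofReal (ε / (2 + ε)) * (∫⁻ ω, phiNormSq (errorCoeff φ Γ f γ n (N ω)) ∂P) ≤
          (∫⁻ ω, (⨅ (M : Set Λ) (_ : M ⊆ Γ), criterion φ f γ ε n (N ω) M) ∂P)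
          + ENNReal.ofReal (c₀ * remainder f n c m γ ε p q) := by
  obtain ⟨C, hC, hbad⟩ := exists_setLIntegral_badEvent_le
  refine ⟨C, hC, ?_⟩
  intro Λ Ω _ P _ n f N φ φt Γ c m γ ε p q hn hf0 hfi hf hN hφm hφ hli _ hsum hsup hov hγ hε _ hp
    hpq _
  have hfin := isFiniteMeasure_meanMeasure n hfi
  refine ⟨?_, ?_⟩
  · filter_upwards [hN.ae_finite] with ω hω
    exact hasSum_errorCoeff hf γ n hsum hω fun x => (hov x).1
  have hne : ∀ l, ¬ φ l =ᵐ[volume] 0 := fun l hl =>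
    hli.ne_zero l 
      (((MemLp.toLp_eq_toLp_iff (hφ l) MemLp.zero).2 hl).trans (MemLp.toLp_zero _))
  have hcount := (countable_of_overlap_bounded hφm hov hne).to_subtype
  have hRm : ∀ l, AEMeasurable (badError N n f (φ l) γ ε) P := fun l =>
    AEMeasurable.indicator₀ (((hN.aemeasurable_coeffHat hfi (hφm l)).sub_const _).pow_const 2
      |>.ennreal_ofReal) (hN.nullMeasurableSet_badEvent hfi (hφm l) _ _)
  have hR : ∫⁻ ω, ∑' l : Γ, badError N n f (φ l) γ ε ω ∂P ≤
      ENNReal.ofReal (C * remainder f n c m γ ε p q) := by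
    rw [lintegral_tsum fun l : Γ => hRm l]
    -- For `n = 1` the overlap bound is `m · ln 1 = 0`, which forces every `φ l` with `l ∈ Γ` to
    -- vanish; linear independence then makes `Γ` empty.
    rcases hn.eq_or_lt with rfl | hn2
    · have : IsEmpty Γ := by
        refine ⟨fun l => hne l (Filter.Eventually.of_forall fun x => ?_)⟩
        by_contra hx
        have h0 := (hov x).2
        rw [Nat.cast_one, Real.log_one, mul_zero] at h0
        have h1 : {l ∈ Γ | φ l x ≠ 0}.ncard = 0 := by exact_mod_cast h0.antisymm (by positivity)
        rw [Set.ncard_eq_zero (hov x).1] at h1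
        exact (Set.eq_empty_iff_forall_notMem.1 h1) l ⟨l.2, hx⟩
      simp
    have hm : 0 ≤ m * Real.log n := (Nat.cast_nonneg _).trans (hov 0).2
    have hconj : p.HolderConjugate q :=
      Real.holderConjugate_iff.2 ⟨by linarith, by simpa only [one_div] using hpq⟩
    set r := (n : ℝ) ^ (-(γ / (q * (1 + ε)))) + (n : ℝ) ^ (-(γ / q)) with hr
    have hr0 : 0 ≤ r := by positivity
    have hl1 : ∫⁻ x, ENNReal.ofReal (f x) = ENNReal.ofReal (l1Norm f) := by
      rw [l1Norm, ofReal_integral_eq_lintegral_ofReal hfi.abs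
        (Filter.Eventually.of_forall fun x => abs_nonneg _)]
      simp_rw [abs_of_nonneg (hf0 _)]
    have hl1nn : 0 ≤ l1Norm f := integral_nonneg fun x => abs_nonneg _
    calc ∑' l : Γ, ∫⁻ ω, badError N n f (φ l) γ ε ω ∂P
        ≤ ∑' l : Γ, ENNReal.ofReal (C * p ^ 2 * c ^ 2 * r) *
            ∫⁻ x in {x | φ l x ≠ 0}, ENNReal.ofReal (f x) := by
          refine ENNReal.tsum_le_tsum fun l => ?_
          rw [badError.eq_def, lintegral_indicator₀ (hN.nullMeasurableSet_badEvent hfi (hφm l) _ _)]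
          exact hbad hn2 hf0 hfi hN (hφm l) (hne l) (hsup l l.2) hγ hε hconj
      _ = ENNReal.ofReal (C * p ^ 2 * c ^ 2 * r) *
            ∑' l : Γ, (volume.withDensity fun x => ENNReal.ofReal (f x)) {x | φ l x ≠ 0} := by
          rw [ENNReal.tsum_mul_left]
          congr 1
          refine tsum_congr fun l => ?_
          exact (withDensity_apply _ ((hφm l) (measurableSet_singleton 0)).compl).symm
      _ ≤ ENNReal.ofReal (C * p ^ 2 * c ^ 2 * r) *
            (ENNReal.ofReal (m * Real.log n) * ENNReal.ofReal (l1Norm f)) := by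
          gcongr
          refine (tsum_measure_ne_zero_le hφm hov _).trans_eq ?_
          rw [withDensity_apply _ MeasurableSet.univ, Measure.restrict_univ, hl1]
      _ ≤ ENNReal.ofReal (C * remainder f n c m γ ε p q) := by
          rw [← ENNReal.ofReal_mul hm, ← ENNReal.ofReal_mul (by positivity)]
          refine ENNReal.ofReal_le_ofReal ?_
          have hmax : 1 ≤ max (l1Norm f) 1 ^ (1 / q) :=
            Real.one_le_rpow (le_max_right _ _) (one_div_nonneg.2 hconj.symm.nonneg)
          -- The factors `1 + ε` and `max(‖f‖₁, 1)^(1/q)` are at least 1, so the remainder obtained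
          -- is no larger than the stated one.
          have hrle : r ≤ (1 + ε) * ((n : ℝ) ^ (-(γ / (q * (1 + ε)))) +
              (n : ℝ) ^ (-(γ / q)) * max (l1Norm f) 1 ^ (1 / q)) := by
            refine le_trans ?_ (le_mul_of_one_le_left (by positivity) (by linarith))
            rw [hr]
            gcongr
            exact le_mul_of_one_le_right (by positivity) hmax
          calc C * p ^ 2 * c ^ 2 * r * (m * Real.log n * l1Norm f)
              = C * p ^ 2 * c ^ 2 * (m * Real.log n * l1Norm f) * r := by ring
            _ ≤ C * p ^ 2 * c ^ 2 * (m * Real.log n * l1Norm f) *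
                ((1 + ε) * ((n : ℝ) ^ (-(γ / (q * (1 + ε)))) +
                  (n : ℝ) ^ (-(γ / q)) * max (l1Norm f) 1 ^ (1 / q))) := by gcongr
            _ = C * remainder f n c m γ ε p q := by rw [remainder]; ring
  calc ENNReal.ofReal (ε / (2 + ε)) * (∫⁻ ω, phiNormSq (errorCoeff φ Γ f γ n (N ω)) ∂P)
      = ∫⁻ ω, ENNReal.ofReal (ε / (2 + ε)) * phiNormSq (errorCoeff φ Γ f γ n (N ω)) ∂P :=
        (lintegral_const_mul' _ _ ENNReal.ofReal_ne_top).symm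
    _ ≤ ∫⁻ ω, ((⨅ (M : Set Λ) (_ : M ⊆ Γ), criterion φ f γ ε n (N ω) M) +
          ∑' l : Γ, badError N n f (φ l) γ ε ω) ∂P := by
        refine lintegral_mono fun ω => ?_
        simp only [ENNReal.iInf_add]
        exact le_iInf₂ fun M hM => phiNormSq_le_criterion N φ f Γ n hε ω hM
    _ ≤ _ := by
        -- Only the error term has to be measurable here, which avoids any question about the
        -- infimum over possibly uncountably many models.
        rw [lintegral_add_right' _ (AEMeasurable.tsum fun l : Γ => hRm l)]
        gcongr
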